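/- Notation. Identify $z=x+iy\in\mathbb C$ with $(x,y)\in\mathbb R^2$ and put $\langle x\rangle=(1+|x|^2)^{1/2}$, $\partial_z=\frac12(\partial_x-i\partial_y)$, $\partial_{\bar z}=\frac12(\partial_x+i\partial_y)$, $H=-4\partial_z\partial_{\bar z}+|z|^2$. Let $\mathcal E$ be the Bargmann–Fock space of all $u\in L^2(\mathbb C)$ of the form $u(z)=f(z)e^{-|z|^2/2}$ with $f$ entire, let $\Pi$ be the orthogonal projector of $L^2(\mathbb C)$ onto $\mathcal E$, and for $s\ge 0$ let $L^{2,s}_{\mathcal E}=\{u\in\mathcal E:\ \langle z\rangle^s u\in L^2(\mathbb C)\}$. Theorem 2.2. For every $s\ge 0$ there is a constant $C>0$, depending only on $s$, such that the following holds. Let $\delta,C_0\in\mathbb R$ and let $W:\mathbb R\times\mathbb C\to\mathbb R$ be a real-valued potential, continuous and bounded in $t$ and smooth in the variables $(x,y)$, such that $$\sup_{0\le k\le\lceil s\rceil}\|\partial_z^kW(t,\cdot)\|_{L^\infty(\mathbb C)}\le C_0\qquad\text{for all }t\in\mathbb R.$$ Let $u_0\in L^{2,s}_{\mathcal E}$,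 and let $u\in\mathcal C(\mathbb R,\mathcal E)$ be any solution of the linear LLL equation $$i\partial_tu-\delta Hu=\Pi\big(W(t,z)u\big),\qquad (t,z)\in\mathbb R\times\mathbb C,\qquad u(0,\cdot)=u_0 .$$ Then for all $t\in\mathbb R$ one has $u(t)\in L^{2,s}_{\mathcal E}$ and $$\|\langle z\rangle^su(t)\|_{L^2(\mathbb C)}\le C\,\|\langle z\rangle^su_0\|_{L^2(\mathbb C)}\,\langle C_0t\rangle^s .$$ -/

import Mathlib

open Complex MeasureTheory Filter Topology
open scoped ContDiff ENNReal ComplexConjugate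

noncomputable section

namespace LLL

/-- The Japanese bracket `⟨x⟩ = (1 + |x|²)^{1/2}`, for `x` in `ℝ` or in `ℂ`. -/
def bracket {V : Type*} [Norm V] (x : V) : ℝ := Real.sqrt (1 + ‖x‖ ^ 2)

/-- The Wirtinger derivative `∂_z = (∂_x - i ∂_y) / 2`. -/
def dz (f : ℂ → ℂ) (z : ℂ) : ℂ := (1 / 2) * (fderiv ℝ f z 1 - I * fderiv ℝ f z I)

/-- The Wirtinger derivative `∂_z̄ = (∂_x + i ∂_y) / 2`. -/
def dzbar (f : ℂ → ℂ) (z : ℂ) : ℂ := (1 / 2) * (fderiv ℝ f z 1 + I * fderiv ℝ f z I)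

/-- The harmonic oscillator `H = -4 ∂_z ∂_z̄ + |z|²` (it is only applied to smooth functions). -/
def harmonicOsc (f : ℂ → ℂ) (z : ℂ) : ℂ := -4 * dz (dzbar f) z + (‖z‖ : ℂ) ^ 2 * f z

/-- The Bargmann-Fock space `𝓔`: the square integrable functions of the form
`u(z) = f(z) exp(-|z|²/2)` with `f` entire. -/
def fock : Set (ℂ → ℂ) :=
  {u | (∃ f : ℂ → ℂ, Differentiable ℂ f ∧
          ∀ z, u z = f z * (Real.exp (-‖z‖ ^ 2 / 2) : ℂ)) ∧
        MemLp u 2 volume}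

/-- The function `⟨z⟩^s u`. -/
def weighted (s : ℝ) (u : ℂ → ℂ) (z : ℂ) : ℂ := ((bracket z ^ s : ℝ) : ℂ) * u z

/-- The weighted Bargmann-Fock space `L^{2,s}_𝓔 = L^{2,s} ∩ 𝓔`. -/
def weightedFock (s : ℝ) : Set (ℂ → ℂ) := {u | u ∈ fock ∧ MemLp (weighted s u) 2 volume}

/-- `v = Π g`, where `Π` is the orthogonal projector of `L²(ℂ)` onto `𝓔`: the function `g` is in
`L²(ℂ)`, `v` is in `𝓔`, and `g - v` is orthogonal to `𝓔`. Elements of `𝓔` are continuous, so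
that `v` is determined pointwise by `g`. -/
def IsFockProj (g v : ℂ → ℂ) : Prop :=
  MemLp g 2 volume ∧ v ∈ fock ∧ ∀ w ∈ fock, ∫ z : ℂ, conj (w z) * (g z - v z) = 0

/-- Potentials that are continuous and bounded in time and smooth in the space variables. -/
structure IsSmoothPotential (W : ℝ → ℂ → ℝ) : Prop where
  smooth : ∀ t, ContDiff ℝ ∞ (W t)
  continuous : ∀ z, Continuous fun t => W t z
  bounded : ∀ z, ∃ M : ℝ, ∀ t, |W t z| ≤ M

/-- `u ∈ C(ℝ, 𝓔)` solves `i ∂_t u - δ H u = Π (W u)` with `u(0) = u₀`. Elements of `𝓔` are smooth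
functions, and the equation is read at every time as an equality of functions on `ℂ`. -/
structure IsSolution (δ : ℝ) (W : ℝ → ℂ → ℝ) (u₀ : ℂ → ℂ) (u : ℝ → ℂ → ℂ) : Prop where
  mem : ∀ t, u t ∈ fock
  continuous : ∀ t₀, Tendsto (fun t => eLpNorm (u t - u t₀) 2 volume) (𝓝 t₀) (𝓝 0)
  initial : u 0 = u₀
  differentiable : ∀ z, Differentiable ℝ fun t => u t z
  equation : ∀ t, IsFockProj (fun z => (W t z : ℂ) * u t z)
    (fun z => I * deriv (fun τ => u τ z) t - (δ : ℂ) * harmonicOsc (u t) z)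

end LLL

end

noncomputable section

namespace LLL

open scoped Nat Real

/-! ### Taylor coefficients of entire functions and radial integrals -/

/-! Write u(t) = f(t) e^{-|z|²/2} with f entire. Since Lebesgue and Gaussian measure are rotation
invariant, monomials are orthogonal for every radial weight, so squared norms of u, weighted or not,
are sums over n of `mass f n` = |f⁽ⁿ⁾(0)|²/n! times a moment. In this basis H is diagonal with real
eigenvalues, so it drops out of the evolution of each mass; only Π(Wu) moves mass between modes.

Fix the final time t, put k = ⌈s⌉ and T = ⟨C₀t⟩ ≥ 1, and consider the diagonal operator S = T^{2k} +
∂^k z^k. On symbols ∂ is the adjoint of multiplication by z, hence ∂^k z^k = (z^k)* z^k. The form of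
S/(l+S), for l > 0, is bounded on L², so it is finite along the solution without any a priori decay.
With g = (l+S)⁻¹f, its time derivative reduces to l · Im⟨g, W ∂^k z^k g⟩. Integrating by parts k
times gives ⟨z^k g, W z^k g⟩, which is real, plus terms in which at least one derivative falls on W
and at least one factor z is lost (`fockForm_iterate_deriv`). A lost factor z costs 1/T relative to
S, so the derivative is at most 2·2^k |C₀|/T times the form itself (`im_tsum_cutoff_le`). As |C₀t| ≤
T, Grönwall bounds the growth up to time t by exp(2·2^k), uniformly in l (`cutoff_energy_le`).

Integrating against l^{θ-1} dl with kθ = s converts S/(l+S) into S^θ (`tsum_rpow_mul_le_of_cutoff`).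
Finally S^θ dominates the moments of ⟨z⟩^{2s} up to a constant (`moment_le`) and is at most a
constant times T^{2s} those moments (`eigen_rpow_le`, `le_moment`). The factor T^{2s} = ⟨C₀t⟩^{2s}
is the claimed growth, squared. -/

/-- The derivatives at the origin of an entire function. -/
def coef (f : ℂ → ℂ) (n : ℕ) : ℂ := iteratedDeriv n f 0

theorem hasSum_coef {f : ℂ → ℂ} (hf : Differentiable ℂ f) (z : ℂ) :
    HasSum (fun n => coef f n / n ! * z ^ n) (f z) := by
  have h := hasSum_taylorSeries_of_entire hf 0 z
  simp only [sub_zero, smul_eq_mul] at h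
  convert! h using 2 with n
  rw [coef]; ring

theorem circleAverage_sq_norm_sum (c : ℕ → ℂ) (N : ℕ) :
    Real.circleAverage (fun w => ‖∑ n ∈ Finset.range N, c n * w ^ n‖ ^ 2) 0 1 =
      ∑ n ∈ Finset.range N, ‖c n‖ ^ 2 := by
  set p : Polynomial ℂ := ∑ n ∈ Finset.range N, Polynomial.monomial n (c n) with hp
  have hc : ∀ i, p.coeff i = if i < N then c i else 0 := by
    intro i
    simp [hp, Polynomial.coeff_monomial]
  have h := p.sum_sq_norm_coeff_eq_circleAverage
  have e1 : (fun θ : ℂ => ‖p.eval θ‖ ^ 2) =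
      fun w => ‖∑ n ∈ Finset.range N, c n * w ^ n‖ ^ 2 := by
    ext w; simp [hp, Polynomial.eval_finsetSum]
  rw [e1] at h
  rw [← h]
  have hsub : p.support ⊆ Finset.range N := by
    intro i hi
    rw [Polynomial.mem_support_iff, hc] at hi
    by_contra hh
    simp_all
  rw [Finset.sum_subset hsub]
  · refine Finset.sum_congr rfl fun i hi => ?_
    rw [hc, if_pos (Finset.mem_range.1 hi)]
  · intro i _ hi
    rw [Polynomial.notMem_support_iff.1 hi]; simp

/-- Parseval's identity for absolutely convergent power series on the unit circle. -/
theorem hasSum_sq_circle {c : ℕ → ℂ} (hc : Summable fun n => ‖c n‖) :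
    HasSum (fun n => ‖c n‖ ^ 2)
      (Real.circleAverage (fun w => ‖∑' n, c n * w ^ n‖ ^ 2) 0 1) := by
  rw [hasSum_iff_tendsto_nat_of_nonneg (fun n => by positivity)]
  simp_rw [← circleAverage_sq_norm_sum, Real.circleAverage_def]
  refine Tendsto.const_smul ?_ _
  have hnorm : ∀ θ : ℝ, ∀ n, ‖c n * circleMap 0 1 θ ^ n‖ = ‖c n‖ := fun θ n => by
    simp
  refine intervalIntegral.tendsto_integral_filter_of_dominated_convergence
    (fun _ => (∑' n, ‖c n‖) ^ 2) ?_ ?_ ?_ ?_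
  · refine Eventually.of_forall fun N => ?_
    have := continuous_circleMap 0 1
    exact Continuous.aestronglyMeasurable (by fun_prop)
  · refine Eventually.of_forall fun N => Eventually.of_forall fun θ _ => ?_
    rw [norm_pow, norm_norm]
    gcongr
    refine (norm_sum_le _ _).trans ?_
    simp_rw [hnorm]
    exact hc.sum_le_tsum _ (fun n _ => norm_nonneg _)
  · exact intervalIntegrable_const
  · refine Eventually.of_forall fun θ _ => ?_
    have : Summable fun n => c n * circleMap 0 1 θ ^ n := by
      refine Summable.of_norm ?_
      simpa only [hnorm] using hc
    exact (this.hasSum.tendsto_sum_nat.norm).pow 2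

theorem lintegral_circle {f : ℂ → ℂ} (hf : Differentiable ℂ f) (z : ℂ) :
    ∫⁻ θ in Set.Ioc 0 (2 * π), ENNReal.ofReal (‖f (circleMap 0 1 θ * z)‖ ^ 2) =
      ENNReal.ofReal (2 * π) * ∑' n, ENNReal.ofReal (‖coef f n‖ ^ 2 / (n ! : ℝ) ^ 2) *
        ENNReal.ofReal (‖z‖ ^ (2 * n)) := by
  have hc : Summable fun n => ‖coef f n / n ! * z ^ n‖ := (hasSum_coef hf z).summable.norm
  have h := hasSum_sq_circle hc
  have hfc := hf.continuous
  have hcont : Continuous fun θ : ℝ => ‖f (circleMap 0 1 θ * z)‖ ^ 2 := by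
    have := continuous_circleMap 0 1
    fun_prop
  have e : ∀ w, ∑' n, coef f n / n ! * z ^ n * w ^ n = f (w * z) := fun w => by
    rw [← (hasSum_coef hf (w * z)).tsum_eq]
    exact tsum_congr fun n => by rw [mul_pow]; ring
  simp_rw [e, Real.circleAverage_def] at h
  have h2 := h.mul_left (2 * π)
  rw [smul_eq_mul, mul_inv_cancel_left₀ (by positivity),
    intervalIntegral.integral_of_le (by positivity)] at h2
  rw [← ofReal_integral_eq_lintegral_ofReal
    (hcont.integrableOn_Ioc) (Eventually.of_forall fun _ => by positivity), ← h2.tsum_eq,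
    ENNReal.ofReal_tsum_of_nonneg (fun n => by positivity) h2.summable, ← ENNReal.tsum_mul_left]
  refine tsum_congr fun n => ?_
  rw [← ENNReal.ofReal_mul (by positivity), ← ENNReal.ofReal_mul (by positivity)]
  congr 2
  rw [norm_mul, norm_div, norm_pow, mul_pow, div_pow, ← pow_mul, mul_comm n 2,
    Complex.norm_natCast]

/-- Parseval's identity for an entire function and a radial weight. -/
theorem lintegral_radial {f : ℂ → ℂ} (hf : Differentiable ℂ f) {ρ : ℝ → ℝ≥0∞}
    (hρ : Measurable ρ) :
    ∫⁻ z : ℂ, ρ ‖z‖ * ENNReal.ofReal (‖f z‖ ^ 2) =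
      ∑' n, ENNReal.ofReal (‖coef f n‖ ^ 2 / (n ! : ℝ) ^ 2) *
        ∫⁻ z : ℂ, ρ ‖z‖ * ENNReal.ofReal (‖z‖ ^ (2 * n)) := by
  have hfc := hf.continuous
  -- The integral is unchanged when f is rotated, so it can be averaged over θ; on each circle
  -- Parseval then removes the cross terms.
  have hrot : ∀ θ : ℝ, ∫⁻ z : ℂ, ρ ‖z‖ * ENNReal.ofReal (‖f (circleMap 0 1 θ * z)‖ ^ 2) =
      ∫⁻ z : ℂ, ρ ‖z‖ * ENNReal.ofReal (‖f z‖ ^ 2) := by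
    intro θ
    have hmp := (rotation (Circle.exp θ)).measurePreserving
    have := hmp.lintegral_comp_emb (rotation (Circle.exp θ)).toHomeomorph.measurableEmbedding
      (fun z => ρ ‖z‖ * ENNReal.ofReal (‖f z‖ ^ 2))
    rw [← this]
    refine lintegral_congr fun z => ?_
    simp [circleMap, rotation_apply, Circle.coe_exp]
  have hpi : ENNReal.ofReal (2 * π) ≠ 0 := by simp [Real.pi_pos]
  have hswap : ENNReal.ofReal (2 * π) * ∫⁻ z : ℂ, ρ ‖z‖ * ENNReal.ofReal (‖f z‖ ^ 2) =
      ∫⁻ z : ℂ, ρ ‖z‖ * ∫⁻ θ in Set.Ioc 0 (2 * π),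
        ENNReal.ofReal (‖f (circleMap 0 1 θ * z)‖ ^ 2) := by
    have hm : Measurable (Function.uncurry fun (θ : ℝ) (z : ℂ) =>
        ρ ‖z‖ * ENNReal.ofReal (‖f (circleMap 0 1 θ * z)‖ ^ 2)) := by
      have : Continuous fun p : ℝ × ℂ => ‖f (circleMap 0 1 p.1 * p.2)‖ ^ 2 := by
        have := continuous_circleMap 0 1
        fun_prop
      have h2 := this.measurable
      unfold Function.uncurry
      fun_prop
    calc _ = ∫⁻ θ in Set.Ioc 0 (2 * π), ∫⁻ z : ℂ,
          ρ ‖z‖ * ENNReal.ofReal (‖f (circleMap 0 1 θ * z)‖ ^ 2) := by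
          simp_rw [hrot]
          simp [mul_comm]
      _ = ∫⁻ z : ℂ, ∫⁻ θ in Set.Ioc 0 (2 * π),
          ρ ‖z‖ * ENNReal.ofReal (‖f (circleMap 0 1 θ * z)‖ ^ 2) :=
          lintegral_lintegral_swap hm.aemeasurable
      _ = _ := by
          refine lintegral_congr fun z => ?_
          rw [lintegral_const_mul]
          have : Continuous fun θ : ℝ => ‖f (circleMap 0 1 θ * z)‖ ^ 2 := by
            have := continuous_circleMap 0 1
            fun_prop
          exact this.measurable.ennreal_ofReal
  rw [← ENNReal.mul_right_inj hpi ENNReal.ofReal_ne_top, hswap]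
  simp_rw [lintegral_circle hf]
  rw [← ENNReal.tsum_mul_left]
  have : ∀ z : ℂ, ρ ‖z‖ * (ENNReal.ofReal (2 * π) *
      ∑' n, ENNReal.ofReal (‖coef f n‖ ^ 2 / (n ! : ℝ) ^ 2) * ENNReal.ofReal (‖z‖ ^ (2 * n))) =
      ∑' n, ENNReal.ofReal (2 * π) * (ENNReal.ofReal (‖coef f n‖ ^ 2 / (n ! : ℝ) ^ 2) *
        (ρ ‖z‖ * ENNReal.ofReal (‖z‖ ^ (2 * n)))) := by
    intro z
    rw [← ENNReal.tsum_mul_left, ← ENNReal.tsum_mul_left]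
    refine tsum_congr fun n => by ring
  simp_rw [this]
  rw [lintegral_tsum (fun n => by fun_prop)]
  refine tsum_congr fun n => ?_
  rw [lintegral_const_mul _ (by fun_prop), lintegral_const_mul _ (by fun_prop)]

/-! ### The Bargmann-Fock space in terms of Taylor coefficients -/

theorem coef_add {f g : ℂ → ℂ} (hf : Differentiable ℂ f) (hg : Differentiable ℂ g) (n : ℕ) :
    coef (fun z => f z + g z) n = coef f n + coef g n := by
  unfold coef
  exact iteratedDeriv_fun_add hf.contDiff.contDiffAt hg.contDiff.contDiffAt

theorem coef_const_mul {f : ℂ → ℂ} (hf : Differentiable ℂ f) (c : ℂ) (n : ℕ) :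
    coef (fun z => c * f z) n = c * coef f n := by
  unfold coef
  exact iteratedDeriv_const_mul c hf.contDiff.contDiffAt

theorem coef_deriv (f : ℂ → ℂ) (n : ℕ) : coef (deriv f) n = coef f (n + 1) := by
  rw [coef, coef, iteratedDeriv_succ']

theorem coef_id_mul_zero (f : ℂ → ℂ) : coef (fun z => z * f z) 0 = 0 := by
  simp [coef]

theorem coef_id_mul_succ {f : ℂ → ℂ} (hf : Differentiable ℂ f) (n : ℕ) :
    coef (fun z => z * f z) (n + 1) = (n + 1) * coef f n := by
  induction n generalizing f with
  | zero =>
    have : deriv (fun z => z * f z) = fun z => f z + z * deriv f z := by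
      ext z
      simpa using ((hasDerivAt_id' z).fun_mul (hf z).hasDerivAt).deriv
    rw [← coef_deriv, this, coef_add hf (differentiable_fun_id.fun_mul hf.deriv), coef_id_mul_zero]
    simp
  | succ n ih =>
    have : deriv (fun z => z * f z) = fun z => f z + z * deriv f z := by
      ext z
      simpa using ((hasDerivAt_id' z).fun_mul (hf z).hasDerivAt).deriv
    rw [← coef_deriv, this, coef_add hf (differentiable_fun_id.fun_mul hf.deriv), ih hf.deriv, coef_deriv]
    push_cast; ring

theorem eq_of_coef_eq {f g : ℂ → ℂ} (hf : Differentiable ℂ f) (hg : Differentiable ℂ g)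
    (h : ∀ n, coef f n = coef g n) : f = g := by
  ext z
  refine (hasSum_coef hf z).unique ?_
  simpa only [h] using hasSum_coef hg z

/-- Coefficients dominated by those of an entire function still give infinite radius of convergence.
This is how diagonal operators such as (l+S)⁻¹ are applied to symbols. -/
theorem exists_coef_eq {f : ℂ → ℂ} (hf : Differentiable ℂ f) {b : ℕ → ℂ} {C : ℝ}
    (hb : ∀ n, ‖b n‖ ≤ C * ‖coef f n‖) :
    ∃ g : ℂ → ℂ, Differentiable ℂ g ∧ ∀ n, coef g n = b n := by
  set p := FormalMultilinearSeries.ofScalars ℂ fun n => b n / n ! with hp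
  have hr : p.radius = ⊤ := by
    refine FormalMultilinearSeries.radius_eq_top_of_summable_norm _ fun r => ?_
    have hs := ((hasSum_coef hf (r : ℂ)).summable.norm).mul_left C
    refine hs.of_nonneg_of_le (fun n => by positivity) fun n => ?_
    rw [hp, FormalMultilinearSeries.ofScalars_norm, norm_mul, norm_div, norm_div, ← mul_assoc,
      mul_div_assoc', norm_pow]
    simp only [norm_real, NNReal.norm_eq]
    gcongr
    exact hb n
  have hB := p.hasFPowerSeriesOnBall (by rw [hr]; exact ENNReal.zero_lt_top)
  rw [hr] at hB
  refine ⟨p.sum, ?_, fun n => ?_⟩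
  · have := hB.differentiableOn
    intro z
    exact this.differentiableAt (by simp)
  · have := hB.factorial_smul (1 : ℂ) n
    rw [coef, iteratedDeriv_eq_iteratedFDeriv, ← this, hp]
    have hn : (n ! : ℂ) ≠ 0 := by exact_mod_cast n.factorial_ne_zero
    simp [mul_div_cancel₀ _ hn]

/-- The function `f(z) exp(-|z|²/2)`. -/
def toFock (f : ℂ → ℂ) (z : ℂ) : ℂ := f z * (Real.exp (-‖z‖ ^ 2 / 2) : ℂ)

/-- The square modulus of the `n`-th coordinate of `toFock f` in the Hermite basis, up to a factor
`π`. -/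
def mass (f : ℂ → ℂ) (n : ℕ) : ℝ := ‖coef f n‖ ^ 2 / n !

theorem mass_nonneg (f : ℂ → ℂ) (n : ℕ) : 0 ≤ mass f n := by unfold mass; positivity

theorem continuous_toFock {f : ℂ → ℂ} (hf : Differentiable ℂ f) : Continuous (toFock f) := by
  have := hf.continuous
  unfold toFock
  fun_prop

theorem norm_toFock_sq (f : ℂ → ℂ) (z : ℂ) :
    ‖toFock f z‖ ^ 2 = Real.exp (-‖z‖ ^ 2) * ‖f z‖ ^ 2 := by
  rw [toFock, norm_mul, norm_real, Real.norm_of_nonneg (Real.exp_pos _).le, mul_pow,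
    ← Real.exp_nat_mul, mul_comm]
  congr 2
  push_cast; ring

theorem integral_moment (n : ℕ) :
    ∫ z : ℂ, Real.exp (-‖z‖ ^ 2) * ‖z‖ ^ (2 * n) = π * n ! := by
  have h := Complex.integral_rpow_mul_exp_neg_rpow (p := 2) (q := 2 * n) (by norm_num)
    (by linarith [(Nat.cast_nonneg n : (0 : ℝ) ≤ n)])
  have e : ((2 : ℝ) * n + 2) / 2 = n + 1 := by ring
  rw [e, Real.Gamma_nat_eq_factorial] at h
  calc _ = _ := integral_congr_ae (Eventually.of_forall fun z => ?_)
    _ = _ := h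
    _ = _ := by ring
  have : (2 : ℝ) * n = ((2 * n : ℕ) : ℝ) := by push_cast; rfl
  simp only [this, Real.rpow_natCast, Real.rpow_two]
  ring

theorem lintegral_moment (n : ℕ) :
    ∫⁻ z : ℂ, ENNReal.ofReal (Real.exp (-‖z‖ ^ 2)) * ENNReal.ofReal (‖z‖ ^ (2 * n)) =
      ENNReal.ofReal (π * n !) := by
  simp_rw [← ENNReal.ofReal_mul (Real.exp_pos _).le]
  rw [← ofReal_integral_eq_lintegral_ofReal, integral_moment]
  -- A non-integrable function has Bochner integral 0, whereas this integral is positive.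
  · by_contra h
    have := integral_moment n
    rw [integral_undef h] at this
    have : 0 < π * n ! := by positivity
    linarith
  · exact Eventually.of_forall fun z => by positivity

theorem lintegral_toFock_sq {f : ℂ → ℂ} (hf : Differentiable ℂ f) :
    ∫⁻ z, ENNReal.ofReal (‖toFock f z‖ ^ 2) = ENNReal.ofReal π * ∑' n, ENNReal.ofReal (mass f n) := by
  simp_rw [norm_toFock_sq, ENNReal.ofReal_mul (Real.exp_pos _).le]
  rw [lintegral_radial hf (ρ := fun r => ENNReal.ofReal (Real.exp (-r ^ 2))) (by fun_prop),
    ← ENNReal.tsum_mul_left]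
  refine tsum_congr fun n => ?_
  rw [lintegral_moment, ← ENNReal.ofReal_mul (by positivity), ← ENNReal.ofReal_mul (by positivity),
    mass]
  congr 1
  field_simp

theorem eLpNorm_two_sq {g : ℂ → ℂ} :
    eLpNorm g 2 volume ^ 2 = ∫⁻ z, ENNReal.ofReal (‖g z‖ ^ 2) := by
  rw [eLpNorm_eq_lintegral_rpow_enorm_toReal (by norm_num) (by norm_num), ← ENNReal.rpow_natCast,
    ← ENNReal.rpow_mul]
  simp [ENNReal.ofReal_pow]

theorem eLpNorm_toFock_sq {f : ℂ → ℂ} (hf : Differentiable ℂ f) :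
    eLpNorm (toFock f) 2 volume ^ 2 = ENNReal.ofReal π * ∑' n, ENNReal.ofReal (mass f n) := by
  rw [eLpNorm_two_sq, lintegral_toFock_sq hf]

theorem memLp_toFock_iff {f : ℂ → ℂ} (hf : Differentiable ℂ f) :
    MemLp (toFock f) 2 volume ↔ Summable (mass f) := by
  have h1 : MemLp (toFock f) 2 volume ↔ eLpNorm (toFock f) 2 volume ^ 2 ≠ ⊤ := by
    rw [MemLp, and_iff_right (continuous_toFock hf).aestronglyMeasurable, lt_top_iff_ne_top]
    simp
  have hpi : ENNReal.ofReal π ≠ 0 := by simp [Real.pi_pos]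
  rw [h1, eLpNorm_toFock_sq hf]
  constructor
  · intro h
    have h2 : ∑' n, ENNReal.ofReal (mass f n) ≠ ⊤ := by
      rintro e
      exact h (by rw [e, ENNReal.mul_top hpi])
    have := ENNReal.summable_toReal h2
    simpa only [ENNReal.toReal_ofReal (mass_nonneg f _)] using this
  · intro h
    rw [← ENNReal.ofReal_tsum_of_nonneg (mass_nonneg f) h]
    exact ENNReal.mul_ne_top ENNReal.ofReal_ne_top ENNReal.ofReal_ne_top

theorem integral_toFock_sq {f : ℂ → ℂ} (hf : Differentiable ℂ f) (hs : Summable (mass f)) :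
    ∫ z, ‖toFock f z‖ ^ 2 = π * ∑' n, mass f n := by
  rw [integral_eq_lintegral_of_nonneg_ae (Eventually.of_forall fun z => by positivity)
    (by have := continuous_toFock hf; fun_prop), lintegral_toFock_sq hf,
    ← ENNReal.ofReal_tsum_of_nonneg (mass_nonneg f) hs, ENNReal.toReal_mul,
    ENNReal.toReal_ofReal Real.pi_pos.le, ENNReal.toReal_ofReal (tsum_nonneg (mass_nonneg f))]

theorem toFock_add_const_mul (f g : ℂ → ℂ) (c : ℂ) :
    toFock (fun z => f z + c * g z) = fun z => toFock f z + c * toFock g z := by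
  ext z; simp only [toFock]; ring

theorem coef_add_const_mul {f g : ℂ → ℂ} (hf : Differentiable ℂ f) (hg : Differentiable ℂ g)
    (c : ℂ) (n : ℕ) : coef (fun z => f z + c * g z) n = coef f n + c * coef g n := by
  rw [coef_add hf (hg.const_mul c), coef_const_mul hg]

theorem summable_mass_add_const_mul {f g : ℂ → ℂ} (hf : Differentiable ℂ f)
    (hg : Differentiable ℂ g) (hfs : Summable (mass f)) (hgs : Summable (mass g)) (c : ℂ) :
    Summable (mass fun z => f z + c * g z) := by
  rw [← memLp_toFock_iff (by fun_prop), toFock_add_const_mul]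
  exact ((memLp_toFock_iff hf).2 hfs).add (((memLp_toFock_iff hg).2 hgs).const_mul c)

/-- Polarization, so that the inner product formula on the Fock space follows from the norm formula.
-/
theorem conj_mul_eq_polarization (a b : ℂ) :
    conj a * b = (((‖a + 1 * b‖ ^ 2 - ‖a + (-1) * b‖ ^ 2) / 4 : ℝ) : ℂ) +
      (((‖a + (-I) * b‖ ^ 2 - ‖a + I * b‖ ^ 2) / 4 : ℝ) : ℂ) * I := by
  simp only [← Complex.normSq_eq_norm_sq, Complex.normSq_apply]
  apply Complex.ext <;> simp <;> ring

/-- The inner product of two elements of the Bargmann-Fock space. -/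
theorem hasSum_integral_conj_toFock_mul {f g : ℂ → ℂ} (hf : Differentiable ℂ f)
    (hg : Differentiable ℂ g) (hfs : Summable (mass f)) (hgs : Summable (mass g)) :
    HasSum (fun n => π * (conj (coef f n) * coef g n / n !))
      (∫ z, conj (toFock f z) * toFock g z) := by
  have key : ∀ c : ℂ, HasSum (fun n => π * (‖coef f n + c * coef g n‖ ^ 2 / n !))
      (∫ z, ‖toFock f z + c * toFock g z‖ ^ 2) := by
    intro c
    have hs := summable_mass_add_const_mul hf hg hfs hgs c
    have h := integral_toFock_sq (f := fun z => f z + c * g z) (by fun_prop) hs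
    rw [toFock_add_const_mul] at h
    rw [h]
    have := hs.hasSum.mul_left π
    simpa only [mass, coef_add_const_mul hf hg] using this
  have hint : ∀ c : ℂ, Integrable fun z => ‖toFock f z + c * toFock g z‖ ^ 2 := fun c =>
    (((memLp_toFock_iff hf).2 hfs).add (((memLp_toFock_iff hg).2 hgs).const_mul c)).integrable_norm_pow
      (by norm_num)
  have h1 := (((key 1).sub (key (-1))).div_const 4)
  have h2 := (((key (-I)).sub (key I)).div_const 4)
  have h3 := (Complex.hasSum_ofReal.2 h1).add ((Complex.hasSum_ofReal.2 h2).mul_right I)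
  convert! h3 using 1
  · ext n
    rw [conj_mul_eq_polarization]
    push_cast
    ring
  · simp_rw [conj_mul_eq_polarization]
    rw [integral_add, integral_mul_const, integral_complex_ofReal, integral_complex_ofReal, integral_div,
      integral_div, integral_sub (hint _) (hint _), integral_sub (hint _) (hint _)]
    · exact (((hint 1).sub (hint (-1))).div_const 4).ofReal
    · exact (((hint (-I)).sub (hint I)).div_const 4).ofReal.mul_const I

/-! ### Integration by parts for `∂_z` -/

theorem dz_mul {f g : ℂ → ℂ} {z : ℂ} (hf : DifferentiableAt ℝ f z) (hg : DifferentiableAt ℝ g z) :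
    dz (fun w => f w * g w) z = dz f z * g z + f z * dz g z := by
  simp only [dz, fderiv_fun_mul hf hg]
  simp
  ring

theorem dz_of_differentiable {f : ℂ → ℂ} {z : ℂ} (hf : DifferentiableAt ℂ f z) :
    dz f z = deriv f z := by
  have h : HasFDerivAt f _ z := hf.hasDerivAt.complexToReal_fderiv
  rw [dz, h.fderiv]
  simp
  ring_nf
  simp
  ring

theorem dz_conj_of_differentiable {f : ℂ → ℂ} {z : ℂ} (hf : DifferentiableAt ℂ f z) :
    dz (fun w => conj (f w)) z = 0 := by
  have h : HasFDerivAt f _ z := hf.hasDerivAt.complexToReal_fderiv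
  have h2 := (conjCLE : ℂ →L[ℝ] ℂ).hasFDerivAt.comp z h
  have h3 : fderiv ℝ (fun w => conj (f w)) z = _ := h2.fderiv
  rw [dz, h3]
  simp
  ring_nf
  simp

theorem differentiable_real_conj {f : ℂ → ℂ} (hf : Differentiable ℂ f) :
    Differentiable ℝ fun w => conj (f w) :=
  (conjCLE : ℂ →L[ℝ] ℂ).differentiable.comp (hf.restrictScalars ℝ)

theorem exp_neg_norm_sq (z : ℂ) : (Real.exp (-‖z‖ ^ 2) : ℂ) = Complex.exp (-(z * conj z)) := by
  rw [Complex.mul_conj, Complex.normSq_eq_norm_sq]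
  push_cast
  rfl

theorem contDiff_gaussian : ContDiff ℝ ∞ fun w : ℂ => (Real.exp (-‖w‖ ^ 2) : ℂ) := by
  have : ContDiff ℝ ∞ fun w : ℂ => Real.exp (-‖w‖ ^ 2) :=
    Real.contDiff_exp.comp (contDiff_norm_sq ℝ).neg
  exact ofRealCLM.contDiff.comp this

theorem dz_gaussian (z : ℂ) :
    dz (fun w => (Real.exp (-‖w‖ ^ 2) : ℂ)) z = -conj z * (Real.exp (-‖z‖ ^ 2) : ℂ) := by
  simp_rw [exp_neg_norm_sq]
  have h1 : HasFDerivAt (fun w : ℂ => w) (ContinuousLinearMap.id ℝ ℂ) z := hasFDerivAt_id z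
  have h2 : HasFDerivAt (fun w : ℂ => conj w) (conjCLE : ℂ →L[ℝ] ℂ) z :=
    (conjCLE : ℂ →L[ℝ] ℂ).hasFDerivAt
  have h3 := ((h1.fun_mul h2).fun_neg).cexp
  rw [dz, h3.fderiv]
  simp
  ring_nf
  simp
  ring

theorem continuous_dz {f : ℂ → ℂ} (hf : ContDiff ℝ 1 f) : Continuous (dz f) := by
  have := hf.continuous_fderiv one_ne_zero
  unfold dz
  fun_prop

theorem integral_fderiv_eq_zero {f : ℂ → ℂ} (hf : ContDiff ℝ 1 f) (hs : HasCompactSupport f)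
    (v : ℂ) : ∫ z, fderiv ℝ f z v = 0 := by
  have hc : Continuous fun z => fderiv ℝ f z v := (hf.continuous_fderiv one_ne_zero).clm_apply continuous_const
  have hi : Integrable fun z => fderiv ℝ f z v :=
    hc.integrable_of_hasCompactSupport (hs.fderiv_apply ℝ v)
  -- Integration by parts against the constant function 1.
  have h := integral_mul_fderiv_eq_neg_fderiv_mul_of_integrable (μ := volume) (𝕜 := ℂ)
    (f := fun _ : ℂ => (1 : ℂ)) (g := f) (v := v) (by simp) (by simpa using hi)
    (by simpa using hf.continuous.integrable_of_hasCompactSupport hs)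
    (fun x _ => differentiableAt_const _) (fun x _ => hf.differentiable one_ne_zero x)
  simpa using h

theorem integral_dz_eq_zero_of_hasCompactSupport {f : ℂ → ℂ} (hf : ContDiff ℝ 1 f)
    (hs : HasCompactSupport f) : ∫ z, dz f z = 0 := by
  have hi : ∀ v : ℂ, Integrable fun z => fderiv ℝ f z v := fun v =>
    ((hf.continuous_fderiv one_ne_zero).clm_apply continuous_const).integrable_of_hasCompactSupport
      (hs.fderiv_apply ℝ v)
  unfold dz
  rw [integral_const_mul, integral_sub (hi 1) ((hi I).const_mul I), integral_const_mul,
    integral_fderiv_eq_zero hf hs, integral_fderiv_eq_zero hf hs]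
  simp

theorem dz_comp_const_mul {χ : ℂ → ℂ} (hχ : Differentiable ℝ χ) (r : ℝ) (z : ℂ) :
    dz (fun w => χ (r * w)) z = r * dz χ (r * z) := by
  have h1 : HasFDerivAt (fun w : ℂ => (r : ℂ) * w) ((r : ℂ) • ContinuousLinearMap.id ℝ ℂ) z :=
    (hasFDerivAt_id z).const_mul (r : ℂ)
  have h2 : fderiv ℝ (fun w => χ (r * w)) z = _ := ((hχ _).hasFDerivAt.comp z h1).fderiv
  have h3 : ∀ v : ℂ, fderiv ℝ χ (r * z) (r * v) = r * fderiv ℝ χ (r * z) v := by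
    intro v
    rw [← Complex.real_smul (x := r) (z := v), map_smul, Complex.real_smul]
  rw [dz, dz, h2]
  have := h3 1
  have := h3 I
  simp_all
  ring

/-- A `C¹` function which is integrable together with its `∂_z` derivative: the integral of the
derivative vanishes. -/
theorem integral_dz_eq_zero {f : ℂ → ℂ} (hf : ContDiff ℝ 1 f) (hi : Integrable f)
    (hd : Integrable (dz f)) : ∫ z, dz f z = 0 := by
  obtain ⟨χ⟩ : Nonempty (ContDiffBump (0 : ℂ)) := ⟨⟨1, 2, one_pos, one_lt_two⟩⟩
  set X : ℂ → ℂ := fun z => (χ z : ℂ) with hX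
  have hXs : ContDiff ℝ 1 X := ofRealCLM.contDiff.comp χ.contDiff
  have hXc : HasCompactSupport X := χ.hasCompactSupport.comp_left (g := ((↑) : ℝ → ℂ)) (by simp)
  have hXle : ∀ z, ‖X z‖ ≤ 1 := fun z => by
    rw [hX, norm_real, Real.norm_of_nonneg χ.nonneg]
    exact χ.le_one
  obtain ⟨C, hC⟩ : ∃ C, ∀ z, ‖dz X z‖ ≤ C := by
    refine ((hXc.fderiv (𝕜 := ℝ)).exists_bound_of_continuous
      (hXs.continuous_fderiv one_ne_zero)).imp fun C hC z => ?_
    have h1 := (fderiv ℝ X z).le_opNorm 1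
    have h2 := (fderiv ℝ X z).le_opNorm I
    have h3 := norm_sub_le (fderiv ℝ X z 1) (I * fderiv ℝ X z I)
    have := hC z
    rw [dz, norm_mul]
    simp at h1 h2 h3 ⊢
    linarith
  -- Dilated cutoffs X(r_n z) with r_n → 0 exhaust the plane, and the derivative of the cutoff
  -- carries a factor r_n, so its contribution vanishes in the limit by dominated convergence.
  set r : ℕ → ℝ := fun n => 1 / ((n : ℝ) + 1) with hr
  have hr0 : ∀ n, r n ≠ 0 := fun n => by positivity
  have hrt : Tendsto r atTop (𝓝 0) := tendsto_one_div_add_atTop_nhds_zero_nat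
  have hXr : ∀ n, ContDiff ℝ 1 fun w : ℂ => X (r n * w) := fun n => by fun_prop
  have hr1 : ∀ n, |r n| ≤ 1 := fun n => by
    rw [hr, abs_of_nonneg (by positivity), div_le_one (by positivity)]
    linarith [(Nat.cast_nonneg n : (0 : ℝ) ≤ n)]
  have hcd := continuous_dz hXs
  have hcX := hXs.continuous
  have i1 : ∀ n, Integrable fun z => dz X (r n * z) * r n * f z := fun n => by
    refine hi.bdd_mul (c := C) (Continuous.aestronglyMeasurable (by fun_prop))
      (Eventually.of_forall fun z => ?_)
    rw [norm_mul, norm_real, Real.norm_eq_abs, ← mul_one C]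
    exact mul_le_mul (hC _) (hr1 n) (abs_nonneg _) ((norm_nonneg _).trans (hC 0))
  have i2 : ∀ n, Integrable fun z => X (r n * z) * dz f z := fun n =>
    hd.bdd_mul (c := 1) (Continuous.aestronglyMeasurable (by fun_prop))
      (Eventually.of_forall fun z => hXle _)
  have h0 : ∀ n, (∫ z, dz X (r n * z) * r n * f z) + ∫ z, X (r n * z) * dz f z = 0 := by
    intro n
    have hs : HasCompactSupport fun w : ℂ => X (r n * w) * f w := by
      have hrn : (r n : ℂ) ≠ 0 := by exact_mod_cast hr0 n
      exact (hXc.comp_homeomorph (Homeomorph.mulLeft₀ _ hrn)).mul_right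
    have := integral_dz_eq_zero_of_hasCompactSupport ((hXr n).mul hf) hs
    rw [← this, ← integral_add (i1 n) (i2 n)]
    refine integral_congr_ae (Eventually.of_forall fun z => ?_)
    simp only
    rw [dz_mul ((hXr n).differentiable one_ne_zero z) (hf.differentiable one_ne_zero z),
      dz_comp_const_mul (hXs.differentiable one_ne_zero)]
    ring
  have l1 : Tendsto (fun n => ∫ z, dz X (r n * z) * r n * f z) atTop (𝓝 (∫ z : ℂ, 0)) := by
    refine tendsto_integral_of_dominated_convergence (fun z => C * ‖f z‖)
      (fun n => (i1 n).aestronglyMeasurable) (hi.norm.const_mul C) (fun n => ?_) ?_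
    · refine Eventually.of_forall fun z => ?_
      rw [norm_mul, norm_mul, norm_real, Real.norm_eq_abs]
      gcongr
      rw [← mul_one C]
      exact mul_le_mul (hC _) (hr1 n) (abs_nonneg _) ((norm_nonneg _).trans (hC 0))
    · refine Eventually.of_forall fun z => ?_
      have : Tendsto (fun n => C * |r n| * ‖f z‖) atTop (𝓝 (C * |0| * ‖f z‖)) :=
        (hrt.abs.const_mul C).mul_const _
      refine squeeze_zero_norm (fun n => ?_) (by simpa using this)
      rw [norm_mul, norm_mul, norm_real, Real.norm_eq_abs]
      gcongr
      exact hC _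
  have l2 : Tendsto (fun n => ∫ z, X (r n * z) * dz f z) atTop (𝓝 (∫ z, dz f z)) := by
    refine tendsto_integral_of_dominated_convergence (fun z => ‖dz f z‖)
      (fun n => (i2 n).aestronglyMeasurable) hd.norm (fun n => ?_) ?_
    · refine Eventually.of_forall fun z => ?_
      rw [norm_mul]
      exact mul_le_of_le_one_left (norm_nonneg _) (hXle _)
    · refine Eventually.of_forall fun z => ?_
      have hX0 : X 0 = 1 := by
        simp [hX, χ.one_of_mem_closedBall (Metric.mem_closedBall_self χ.rIn_pos.le)]
      have hz : Tendsto (fun n => (r n : ℂ) * z) atTop (𝓝 0) := by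
        have := (continuous_ofReal.tendsto 0).comp hrt |>.mul_const z
        simpa using this
      have := ((hcX.tendsto 0).comp hz).mul_const (dz f z)
      simpa [hX0] using this
  have hl := l1.add l2
  simp_rw [h0, integral_zero, zero_add] at hl
  exact (tendsto_nhds_unique tendsto_const_nhds hl).symm

/-- Elements of the Bargmann-Fock space, written as entire functions. -/
structure IsFockSymbol (f : ℂ → ℂ) : Prop where
  differentiable : Differentiable ℂ f
  summable : Summable (mass f)

theorem IsFockSymbol.memLp {f : ℂ → ℂ} (hf : IsFockSymbol f) : MemLp (toFock f) 2 volume :=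
  (memLp_toFock_iff hf.differentiable).2 hf.summable

theorem conj_toFock_mul_toFock (f g : ℂ → ℂ) (z : ℂ) :
    conj (toFock f z) * toFock g z = conj (f z) * g z * (Real.exp (-‖z‖ ^ 2) : ℂ) := by
  have : Real.exp (-‖z‖ ^ 2) = Real.exp (-‖z‖ ^ 2 / 2) * Real.exp (-‖z‖ ^ 2 / 2) := by
    rw [← Real.exp_add]; ring_nf
  rw [this, toFock, toFock, map_mul, conj_ofReal]
  push_cast
  ring

theorem integrable_conj_toFock_mul {f g : ℂ → ℂ} (hf : IsFockSymbol f) (hg : IsFockSymbol g) :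
    Integrable fun z => conj (toFock f z) * toFock g z :=
  hf.memLp.star.integrable_mul hg.memLp

/-- The sesquilinear form of the multiplication by `V` on the Bargmann-Fock space. -/
def fockForm (V f g : ℂ → ℂ) : ℂ := ∫ z, V z * (conj (toFock f z) * toFock g z)

theorem integrable_fockForm {V f g : ℂ → ℂ} (hV : Continuous V) {A : ℝ} (hA : ∀ z, ‖V z‖ ≤ A)
    (hf : IsFockSymbol f) (hg : IsFockSymbol g) :
    Integrable fun z => V z * (conj (toFock f z) * toFock g z) :=
  (integrable_conj_toFock_mul hf hg).bdd_mul hV.aestronglyMeasurable (Eventually.of_forall hA)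

/-- The integral of ∂_z(V f̄ g e^{-|z|²}) vanishes. Here ∂_z annihilates f̄ and produces -z̄ from
the Gaussian, which joins f̄ as the conjugate of zf. Thus ∂ and z are adjoint up to the commutator
term carrying ∂_z V. -/
theorem fockForm_deriv {V f g : ℂ → ℂ} (hV : ContDiff ℝ 1 V) {A : ℝ} (hA : ∀ z, ‖V z‖ ≤ A)
    (hA' : ∀ z, ‖dz V z‖ ≤ A) (hf : IsFockSymbol f) (hf' : IsFockSymbol fun z => z * f z)
    (hg : IsFockSymbol g) (hg' : IsFockSymbol (deriv g)) :
    fockForm V f (deriv g) = fockForm V (fun z => z * f z) g - fockForm (dz V) f g := by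
  have hfr := differentiable_real_conj hf.differentiable
  have hgr : Differentiable ℝ g := hg.differentiable.restrictScalars ℝ
  have hVr := hV.differentiable one_ne_zero
  have her := contDiff_gaussian.differentiable (by simp)
  set P : ℂ → ℂ := fun z => V z * (conj (f z) * (g z * (Real.exp (-‖z‖ ^ 2) : ℂ))) with hP
  have hd : ∀ z, dz P z = dz V z * (conj (toFock f z) * toFock g z) +
      (V z * (conj (toFock f z) * toFock (deriv g) z) -
        V z * (conj (toFock (fun z => z * f z) z) * toFock g z)) := by
    intro z
    rw [hP, dz_mul (hVr z) ((hfr z).fun_mul ((hgr z).fun_mul (her z))),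
      dz_mul (hfr z) ((hgr z).fun_mul (her z)), dz_mul (hgr z) (her z),
      dz_conj_of_differentiable (hf.differentiable z), dz_of_differentiable (hg.differentiable z),
      dz_gaussian, conj_toFock_mul_toFock, conj_toFock_mul_toFock, conj_toFock_mul_toFock, map_mul]
    ring
  have i1 := integrable_fockForm (continuous_dz hV) hA' hf hg
  have i2 := integrable_fockForm hV.continuous hA hf hg'
  have i3 := integrable_fockForm hV.continuous hA hf' hg
  have hPs : ContDiff ℝ 1 P := by
    have h1 : ContDiff ℝ 1 fun z => conj (f z) :=
      (conjCLE : ℂ →L[ℝ] ℂ).contDiff.comp (hf.differentiable.contDiff.restrict_scalars ℝ)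
    have h2 : ContDiff ℝ 1 g := hg.differentiable.contDiff.restrict_scalars ℝ
    exact hV.mul (h1.mul (h2.mul (contDiff_gaussian.of_le (by norm_cast))))
  have hPi : Integrable P := by
    refine (integrable_fockForm hV.continuous hA hf hg).congr (Eventually.of_forall fun z => ?_)
    simp only [hP, conj_toFock_mul_toFock]
    ring
  have := integral_dz_eq_zero hPs hPi ((i1.add (i2.sub i3)).congr
    (Eventually.of_forall fun z => (hd z).symm))
  simp_rw [hd] at this
  have e := integral_add i1 (i2.sub i3)
  simp only [Pi.sub_apply] at e
  rw [e, integral_sub i2 i3] at this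
  unfold fockForm
  linear_combination this

/-! ### Multiplication by `z` and differentiation of symbols -/

theorem IsFockSymbol.add_const_mul {f g : ℂ → ℂ} (hf : IsFockSymbol f) (hg : IsFockSymbol g)
    (c : ℂ) : IsFockSymbol fun z => f z + c * g z :=
  ⟨hf.differentiable.add (hg.differentiable.const_mul c),
    summable_mass_add_const_mul hf.differentiable hg.differentiable hf.summable hg.summable c⟩

theorem mass_id_mul_zero (f : ℂ → ℂ) : mass (fun z => z * f z) 0 = 0 := by
  simp [mass, coef_id_mul_zero]

theorem mass_id_mul_succ {f : ℂ → ℂ} (hf : Differentiable ℂ f) (n : ℕ) :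
    mass (fun z => z * f z) (n + 1) = (n + 1) * mass f n := by
  have : ‖((n : ℂ) + 1)‖ = n + 1 := by
    exact_mod_cast Complex.norm_natCast (n + 1)
  rw [mass, mass, coef_id_mul_succ hf, norm_mul, this, Nat.factorial_succ]
  have : (n ! : ℝ) ≠ 0 := by positivity
  push_cast
  field_simp

theorem pow_succ_mul_eq (f : ℂ → ℂ) (i : ℕ) :
    (fun z => z ^ (i + 1) * f z) = fun z => z * (z ^ i * f z) := by
  ext z; ring

theorem differentiable_pow_mul {f : ℂ → ℂ} (hf : Differentiable ℂ f) (i : ℕ) :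
    Differentiable ℂ fun z => z ^ i * f z := by fun_prop

/-- Multiplication by z^i shifts modes by i, kills the first i of them, and multiplies masses by
(n+1)⋯(n+i). -/
theorem hasSum_mass_pow_mul_iff {f : ℂ → ℂ} (hf : Differentiable ℂ f) (i : ℕ) (a : ℝ) :
    HasSum (mass fun z => z ^ i * f z) a ↔
      HasSum (fun n => ((n + 1).ascFactorial i : ℝ) * mass f n) a := by
  have key : ∀ n, mass (fun z => z ^ i * f z) (n + i) = ((n + 1).ascFactorial i : ℝ) * mass f n := by
    induction i with
    | zero => intro n; simp
    | succ i ih =>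
      intro n
      rw [pow_succ_mul_eq, ← add_assoc, mass_id_mul_succ (differentiable_pow_mul hf i), ih,
        Nat.ascFactorial_succ]
      push_cast; ring
  have hz : ∀ n < i, mass (fun z => z ^ i * f z) n = 0 := by
    clear key
    induction i with
    | zero => simp
    | succ i ih =>
      intro n hn
      rw [pow_succ_mul_eq]
      cases n with
      | zero => exact mass_id_mul_zero _
      | succ n =>
        rw [mass_id_mul_succ (differentiable_pow_mul hf i), ih n (by omega), mul_zero]
  rw [← hasSum_nat_add_iff' i, Finset.sum_eq_zero (fun n hn => hz n (Finset.mem_range.1 hn)),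
    sub_zero]
  simp_rw [key]

theorem IsFockSymbol.of_pow_mul {f : ℂ → ℂ} (hf : Differentiable ℂ f) {i k : ℕ} (hik : i ≤ k)
    (h : IsFockSymbol fun z => z ^ k * f z) : IsFockSymbol fun z => z ^ i * f z := by
  refine ⟨differentiable_pow_mul hf i, ?_⟩
  obtain ⟨a, ha⟩ := h.summable
  have ha' := ((hasSum_mass_pow_mul_iff hf k a).1 ha).summable
  obtain ⟨b, hb⟩ : Summable fun n => ((n + 1).ascFactorial i : ℝ) * mass f n := by
    refine ha'.of_nonneg_of_le (fun n => mul_nonneg (by positivity) (mass_nonneg f n)) fun n => ?_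
    gcongr
    · exact mass_nonneg f n
    · obtain ⟨j, rfl⟩ := Nat.exists_eq_add_of_le hik
      rw [← Nat.ascFactorial_mul_ascFactorial]
      exact Nat.le_mul_of_pos_right _ (by rw [Nat.add_right_comm]; exact Nat.ascFactorial_pos _ _)
  exact ((hasSum_mass_pow_mul_iff hf i b).2 hb).summable

theorem mass_deriv (f : ℂ → ℂ) (n : ℕ) : mass (deriv f) n = (n + 1) * mass f (n + 1) := by
  rw [mass, mass, coef_deriv, Nat.factorial_succ]
  have : (n ! : ℝ) ≠ 0 := by positivity
  push_cast
  field_simp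

theorem IsFockSymbol.of_deriv {f : ℂ → ℂ} (hf : Differentiable ℂ f)
    (h : IsFockSymbol (deriv f)) : IsFockSymbol f := by
  refine ⟨hf, ?_⟩
  rw [← summable_nat_add_iff 1]
  refine h.summable.of_nonneg_of_le (fun n => mass_nonneg _ _) fun n => ?_
  rw [mass_deriv]
  exact le_mul_of_one_le_left (mass_nonneg _ _) (by linarith [(Nat.cast_nonneg n : (0 : ℝ) ≤ n)])

theorem differentiable_iterate_deriv {f : ℂ → ℂ} (hf : Differentiable ℂ f) (l : ℕ) :
    Differentiable ℂ (deriv^[l] f) := by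
  induction l with
  | zero => simpa
  | succ l ih => rw [Function.iterate_succ_apply']; exact ih.deriv

theorem IsFockSymbol.of_iterate_deriv {f : ℂ → ℂ} (hf : Differentiable ℂ f) {l k : ℕ}
    (hlk : l ≤ k) (h : IsFockSymbol (deriv^[k] f)) : IsFockSymbol (deriv^[l] f) := by
  induction k, hlk using Nat.le_induction with
  | base => exact h
  | succ k hk ih =>
    rw [Function.iterate_succ_apply'] at h
    exact ih (h.of_deriv (differentiable_iterate_deriv hf k))

theorem coef_iterate_deriv (f : ℂ → ℂ) (l n : ℕ) : coef (deriv^[l] f) n = coef f (n + l) := by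
  induction l generalizing n with
  | zero => simp
  | succ l ih => rw [Function.iterate_succ_apply', coef_deriv, ih]; congr 1; omega

/-- Thus ∂^k z^k is diagonal, which makes its resolvent explicit on Taylor coefficients. -/
theorem coef_iterate_deriv_pow_mul {f : ℂ → ℂ} (hf : Differentiable ℂ f) (k n : ℕ) :
    coef (deriv^[k] fun z => z ^ k * f z) n = ((n + 1).ascFactorial k : ℂ) * coef f n := by
  rw [coef_iterate_deriv]
  induction k with
  | zero => simp
  | succ k ih =>
    rw [pow_succ_mul_eq, ← add_assoc, coef_id_mul_succ (differentiable_pow_mul hf k), ih,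
      Nat.ascFactorial_succ]
    push_cast; ring

/-! ### Bounds for the form of a multiplication operator -/

/-- The norm of an element of the Bargmann-Fock space in terms of its symbol. -/
def fockNorm (f : ℂ → ℂ) : ℝ := √(π * ∑' n, mass f n)

theorem fockNorm_nonneg (f : ℂ → ℂ) : 0 ≤ fockNorm f := Real.sqrt_nonneg _

theorem fockNorm_sq (f : ℂ → ℂ) : fockNorm f ^ 2 = π * ∑' n, mass f n :=
  Real.sq_sqrt (mul_nonneg Real.pi_pos.le (tsum_nonneg (mass_nonneg f)))

theorem norm_fockForm_le {V f g : ℂ → ℂ} {A : ℝ} (hA : ∀ z, ‖V z‖ ≤ A) (hf : IsFockSymbol f)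
    (hg : IsFockSymbol g) : ‖fockForm V f g‖ ≤ A * fockNorm f * fockNorm g := by
  have hA0 : 0 ≤ A := (norm_nonneg _).trans (hA 0)
  have h1 : ‖fockForm V f g‖ ≤ ∫ z, A * (‖toFock f z‖ * ‖toFock g z‖) := by
    refine norm_integral_le_of_norm_le ?_ (Eventually.of_forall fun z => ?_)
    · refine Integrable.const_mul ?_ A
      exact (integrable_conj_toFock_mul hf hg).norm.congr (Eventually.of_forall fun z => by simp)
    · rw [norm_mul, norm_mul, RCLike.norm_conj]
      gcongr
      exact hA z
  have h2 := integral_mul_le_Lp_mul_Lq_of_nonneg (μ := volume) Real.HolderConjugate.two_two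
    (f := fun z => ‖toFock f z‖) (g := fun z => ‖toFock g z‖)
    (Eventually.of_forall fun z => norm_nonneg _) (Eventually.of_forall fun z => norm_nonneg _)
    (by simpa using hf.memLp.norm) (by simpa using hg.memLp.norm)
  simp only [Real.rpow_two, integral_toFock_sq hf.differentiable hf.summable,
    integral_toFock_sq hg.differentiable hg.summable, ← Real.sqrt_eq_rpow] at h2
  rw [integral_const_mul] at h1
  calc _ ≤ _ := h1
    _ ≤ A * (fockNorm f * fockNorm g) := by gcongr; exact h2
    _ = _ := by ring

theorem contDiff_dz {V : ℂ → ℂ} (hV : ContDiff ℝ ∞ V) : ContDiff ℝ ∞ (dz V) := by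
  have h : ContDiff ℝ ∞ (fderiv ℝ V) := hV.fderiv_right (by simp)
  unfold dz
  exact contDiff_const.mul ((h.clm_apply contDiff_const).sub
    (contDiff_const.mul (h.clm_apply contDiff_const)))

/-- Each derivative moved off g either adds a factor z to f or differentiates V, so m steps create
2^m terms. Exactly one of them has no derivative on V; the other 2^m - 1 have lost at least one z,
whence the index i + m - 1. The plain bound and the refined one go through the induction together,
since a term in which V has been differentiated needs only the plain bound. For m = 0 the truncated
subtraction is harmless because the prefactor is 0. -/
theorem fockForm_iterate_deriv {k : ℕ} {f g : ℂ → ℂ}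
    (hf : ∀ i ≤ k, IsFockSymbol fun z => z ^ i * f z) (hg : ∀ l ≤ k, IsFockSymbol (deriv^[l] g))
    {ν : ℕ → ℝ} (hν : Monotone ν) (hfν : ∀ i ≤ k, fockNorm (fun z => z ^ i * f z) ≤ ν i)
    {A : ℝ} (hA0 : 0 ≤ A) (m : ℕ) {V : ℂ → ℂ} (hV : ContDiff ℝ ∞ V)
    (hA : ∀ j ≤ m, ∀ z, ‖dz^[j] V z‖ ≤ A) {i : ℕ} (him : i + m ≤ k) :
    ‖fockForm V (fun z => z ^ i * f z) (deriv^[m] g)‖ ≤ 2 ^ m * (A * ν (i + m) * fockNorm g) ∧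
    ‖fockForm V (fun z => z ^ i * f z) (deriv^[m] g) -
      fockForm V (fun z => z ^ (i + m) * f z) g‖ ≤
        (2 ^ m - 1) * (A * ν (i + m - 1) * fockNorm g) := by
  induction m generalizing V i with
  | zero =>
    have h := norm_fockForm_le (hA 0 le_rfl) (hf i (by omega)) (hg 0 (by omega))
    refine ⟨?_, by simp⟩
    simp only [Function.iterate_zero, id, pow_zero, one_mul, add_zero] at h ⊢
    refine h.trans ?_
    have := fockNorm_nonneg g
    gcongr
    exact hfν i (by omega)
  | succ m ih =>
    have hA' : ∀ j ≤ m, ∀ z, ‖dz^[j] (dz V) z‖ ≤ A := fun j hj => hA (j + 1) (by omega)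
    obtain ⟨a1, a2⟩ := ih hV (fun j hj => hA j (by omega)) (i := i + 1) (by omega)
    obtain ⟨b1, -⟩ := ih (contDiff_dz hV) hA' (i := i) (by omega)
    have e : fockForm V (fun z => z ^ i * f z) (deriv^[m + 1] g) =
        fockForm V (fun z => z ^ (i + 1) * f z) (deriv^[m] g) -
          fockForm (dz V) (fun z => z ^ i * f z) (deriv^[m] g) := by
      have h1 := hf (i + 1) (by omega)
      have h2 := hg (m + 1) (by omega)
      rw [Function.iterate_succ_apply'] at h2 ⊢
      rw [pow_succ_mul_eq] at h1 ⊢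
      exact fockForm_deriv (hV.of_le (by norm_cast)) (hA 0 (by omega)) (hA 1 (by omega))
        (hf i (by omega)) h1 (hg m (by omega)) h2
    have e1 : i + 1 + m = i + (m + 1) := by omega
    have e2 : i + (m + 1) - 1 = i + m := by omega
    have e3 : i + 1 + m - 1 = i + m := by omega
    rw [e3, e1] at a2
    rw [e1] at a1
    rw [e, e2]
    have hν1 : A * ν (i + m) * fockNorm g ≤ A * ν (i + (m + 1)) * fockNorm g := by
      have := fockNorm_nonneg g
      gcongr
      exact hν (by omega)
    constructor
    · refine (norm_sub_le _ _).trans ?_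
      have : (0 : ℝ) ≤ 2 ^ m := by positivity
      rw [pow_succ]
      nlinarith
    · rw [sub_right_comm]
      refine (norm_sub_le _ _).trans ?_
      rw [pow_succ]
      linarith

/-! ### The commutator estimate -/

/-- The eigenvalues of `T^{2k} + (z^k)* z^k` on the Bargmann-Fock space. -/
def eigen (k : ℕ) (T : ℝ) (n : ℕ) : ℝ := T ^ (2 * k) + (n + 1).ascFactorial k

theorem eigen_pos (k : ℕ) (T : ℝ) (n : ℕ) : 0 < eigen k T n := by
  have : (0 : ℝ) < (n + 1).ascFactorial k := by exact_mod_cast Nat.ascFactorial_pos n k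
  have := (even_two_mul k).pow_nonneg T
  unfold eigen
  linarith

/-- Compare T² with n+i+1. If T² is smaller, it is at most each of the k-i remaining factors of
(n+1)⋯(n+k); if larger, it bounds each of the first i factors. Consequently each power of z missing
from z^k gains 1/T. -/
theorem pow_mul_ascFactorial_le_eigen {k i : ℕ} (hik : i ≤ k) {T : ℝ} (hT : 0 ≤ T) (n : ℕ) :
    T ^ (2 * (k - i)) * (n + 1).ascFactorial i ≤ eigen k T n := by
  obtain ⟨j, rfl⟩ := Nat.exists_eq_add_of_le hik
  rw [Nat.add_sub_cancel_left, eigen]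
  rcases le_total (T ^ 2) (n + i + 1) with h | h
  · have h1 : T ^ (2 * j) ≤ (n + 1 + i).ascFactorial j := by
      calc T ^ (2 * j) = (T ^ 2) ^ j := by rw [pow_mul]
        _ ≤ ((n : ℝ) + i + 1) ^ j := by gcongr
        _ ≤ _ := by
          have := Nat.pow_succ_le_ascFactorial (n + 1 + i) j
          have e : (n : ℝ) + i + 1 = ((n + 1 + i : ℕ) : ℝ) := by push_cast; ring
          rw [e]
          exact_mod_cast this
    have h2 : (n + 1).ascFactorial (i + j) = (n + 1).ascFactorial i * (n + 1 + i).ascFactorial j :=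
      (Nat.ascFactorial_mul_ascFactorial _ _ _).symm
    rw [h2]
    push_cast
    have : 0 ≤ T ^ (2 * (i + j)) := by positivity
    have : T ^ (2 * j) * ((n + 1).ascFactorial i : ℝ) ≤
      (n + 1 + i).ascFactorial j * ((n + 1).ascFactorial i : ℝ) := by gcongr
    linarith
  · have h1 : ((n + 1).ascFactorial i : ℝ) ≤ T ^ (2 * i) := by
      calc ((n + 1).ascFactorial i : ℝ) ≤ ((n + i : ℕ) : ℝ) ^ i := by
            exact_mod_cast Nat.ascFactorial_le_pow_add n i
        _ ≤ (T ^ 2) ^ i := by gcongr; push_cast; linarith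
        _ = _ := by rw [pow_mul]
    have : T ^ (2 * j) * ((n + 1).ascFactorial i : ℝ) ≤ T ^ (2 * j) * T ^ (2 * i) := by gcongr
    have e : T ^ (2 * (i + j)) = T ^ (2 * j) * T ^ (2 * i) := by ring
    rw [e]
    have : (0 : ℝ) ≤ (n + 1).ascFactorial (i + j) := by positivity
    linarith

theorem fockForm_self_im (W : ℂ → ℝ) (f : ℂ → ℂ) : (fockForm (fun z => W z) f f).im = 0 := by
  have : fockForm (fun z => W z) f f = ((∫ z, W z * ‖toFock f z‖ ^ 2 : ℝ) : ℂ) := by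
    rw [fockForm, ← integral_complex_ofReal]
    refine integral_congr_ae (Eventually.of_forall fun z => ?_)
    simp only
    rw [Complex.conj_mul']
    push_cast
    rfl
  rw [this, ofReal_im]

theorem fockForm_add_const_mul_right {V f g h : ℂ → ℂ} (hV : Continuous V) {A : ℝ}
    (hA : ∀ z, ‖V z‖ ≤ A) (hf : IsFockSymbol f) (hg : IsFockSymbol g) (hh : IsFockSymbol h)
    (c : ℂ) : fockForm V h (fun z => f z + c * g z) = fockForm V h f + c * fockForm V h g := by
  unfold fockForm
  rw [← integral_const_mul, ← integral_add (integrable_fockForm hV hA hh hf)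
    ((integrable_fockForm hV hA hh hg).const_mul c)]
  refine integral_congr_ae (Eventually.of_forall fun z => ?_)
  simp only [toFock_add_const_mul]
  ring

theorem fockForm_add_const_mul_left {V f g h : ℂ → ℂ} (hV : Continuous V) {A : ℝ}
    (hA : ∀ z, ‖V z‖ ≤ A) (hf : IsFockSymbol f) (hg : IsFockSymbol g) (hh : IsFockSymbol h)
    (c : ℂ) : fockForm V (fun z => f z + c * g z) h =
      fockForm V f h + conj c * fockForm V g h := by
  unfold fockForm
  rw [← integral_const_mul, ← integral_add (integrable_fockForm hV hA hf hh)
    ((integrable_fockForm hV hA hg hh).const_mul (conj c))]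
  refine integral_congr_ae (Eventually.of_forall fun z => ?_)
  simp only [toFock_add_const_mul, map_add, map_mul]
  ring

/-- The weights which truncate `eigen k T`. -/
def cutoff (k : ℕ) (T l : ℝ) (n : ℕ) : ℝ := eigen k T n / (l + eigen k T n)

theorem cutoff_nonneg (k : ℕ) (T : ℝ) {l : ℝ} (hl : 0 < l) (n : ℕ) : 0 ≤ cutoff k T l n := by
  have := eigen_pos k T n
  unfold cutoff
  positivity

theorem cutoff_le_one (k : ℕ) (T : ℝ) {l : ℝ} (hl : 0 < l) (n : ℕ) : cutoff k T l n ≤ 1 := by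
  have := eigen_pos k T n
  rw [cutoff, div_le_one (by positivity)]
  linarith

/-- The commutator bound for W with S/(l+S) = 1 - l(l+S)⁻¹: the identity commutes with W, and the
resolvent part is controlled by integrating by parts in S. The constant does not depend on l. -/
theorem im_tsum_cutoff_le {k : ℕ} {T l A : ℝ} (hT : 1 ≤ T) (hl : 0 < l) {W : ℂ → ℝ}
    (hW : ContDiff ℝ ∞ W) (hA : ∀ j ≤ k, ∀ z, ‖dz^[j] (fun z => (W z : ℂ)) z‖ ≤ A)
    {f v : ℂ → ℂ} (hf : IsFockSymbol f) (hv : IsFockSymbol v)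
    (hproj : ∀ w, IsFockSymbol w →
      ∫ z, conj (toFock w z) * ((W z : ℂ) * toFock f z - toFock v z) = 0) :
    |(∑' n, (cutoff k T l n : ℂ) * (conj (coef f n) * coef v n / n !)).im| ≤
      2 ^ k * (A / T) * ∑' n, cutoff k T l n * mass f n := by
  have hA0 : 0 ≤ A := (norm_nonneg _).trans (hA 0 (by omega) 0)
  have hT0 : 0 < T := by linarith
  set S := eigen k T with hS
  have hSpos : ∀ n, 0 < S n := eigen_pos k T
  have hlS : ∀ n, 0 < l + S n := fun n => by linarith [hSpos n]
  have hlSc : ∀ n, ((l : ℂ) + S n) ≠ 0 := fun n => by exact_mod_cast (hlS n).ne'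
  -- g = (l+S)⁻¹ f; below, h = ∂^k z^k g, so that f = h + (l + T^{2k}) g.
  obtain ⟨g, hgd, hg⟩ : ∃ g : ℂ → ℂ, Differentiable ℂ g ∧ ∀ n, coef g n = coef f n / (l + S n) := by
    refine exists_coef_eq hf.differentiable (C := 1 / l) fun n => ?_
    rw [norm_div, ← ofReal_add, norm_real, Real.norm_of_nonneg (hlS n).le, div_eq_mul_inv,
      mul_comm, one_div]
    gcongr
    linarith [hSpos n]
  have hgm : ∀ n, mass g n = mass f n / (l + S n) ^ 2 := fun n => by
    rw [mass, mass, hg, norm_div, ← ofReal_add, norm_real, Real.norm_of_nonneg (hlS n).le]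
    field_simp
  have hgs : IsFockSymbol g := by
    refine ⟨hgd, (hf.summable.div_const (l ^ 2)).of_nonneg_of_le (mass_nonneg g) fun n => ?_⟩
    rw [hgm]
    have := mass_nonneg f n
    gcongr
    linarith [hSpos n]
  set h : ℂ → ℂ := deriv^[k] fun z => z ^ k * g z with hh
  have hhd : Differentiable ℂ h := differentiable_iterate_deriv (differentiable_pow_mul hgd k) k
  have hfg : f = fun z => h z + ((l : ℂ) + (T : ℂ) ^ (2 * k)) * g z := by
    refine eq_of_coef_eq hf.differentiable (hhd.add (hgd.const_mul _)) fun n => ?_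
    rw [coef_add_const_mul hhd hgd, hh, coef_iterate_deriv_pow_mul hgd, hg]
    have e : (l : ℂ) + S n = l + (T ^ (2 * k) + (n + 1).ascFactorial k) := by
      simp [hS, eigen]
    have := hlSc n
    rw [e] at this ⊢
    field_simp
    ring
  have hhs : IsFockSymbol h := by
    have := hf.add_const_mul hgs (-((l : ℂ) + (T : ℂ) ^ (2 * k)))
    convert! this using 1
    ext z
    linear_combination -congrFun hfg z
  have hgk : ∀ j ≤ k, IsFockSymbol (deriv^[j] fun z => z ^ k * g z) := fun j hj =>
    IsFockSymbol.of_iterate_deriv (differentiable_pow_mul hgd k) hj hhs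
  have hgi : ∀ i ≤ k, IsFockSymbol fun z => z ^ i * g z := fun i hi =>
    IsFockSymbol.of_pow_mul hgd hi (hgk 0 (by omega))
  -- Modewise l S/(l+S)² ≤ S/(l+S): the S-energy N of g, multiplied by l, is controlled by the
  -- truncated energy of f.
  have hqle : ∀ n, l * (S n * mass g n) ≤ cutoff k T l n * mass f n := by
    intro n
    rw [hgm, cutoff, ← hS]
    have h1 := hSpos n
    have h2 := mass_nonneg f n
    have h3 := hlS n
    have : l / (l + S n) ≤ 1 := by rw [div_le_one h3]; linarith
    calc l * (S n * (mass f n / (l + S n) ^ 2)) =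
        l / (l + S n) * (S n / (l + S n) * mass f n) := by field_simp
      _ ≤ _ := mul_le_of_le_one_left (by positivity) this
  have hqs : Summable fun n => cutoff k T l n * mass f n :=
    hf.summable.of_nonneg_of_le (fun n => mul_nonneg (cutoff_nonneg k T hl n) (mass_nonneg f n))
      fun n => mul_le_of_le_one_left (mass_nonneg f n) (cutoff_le_one k T hl n)
  have hSs : Summable fun n => S n * mass g n := by
    have : Summable fun n => l * (S n * mass g n) :=
      hqs.of_nonneg_of_le (fun n => mul_nonneg hl.le (mul_nonneg (hSpos n).le (mass_nonneg g n))) hqle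
    exact (summable_mul_left_iff hl.ne').1 this
  set N := ∑' n, S n * mass g n with hN
  have hN0 : 0 ≤ N := tsum_nonneg fun n => mul_nonneg (hSpos n).le (mass_nonneg g n)
  have hlN : l * N ≤ ∑' n, cutoff k T l n * mass f n := by
    rw [hN, ← tsum_mul_left]
    exact (hSs.mul_left l).tsum_le_tsum hqle hqs
  -- That is, ‖z^i g‖ ≤ T^{i-k} √(πN), written without subtraction so that the bound is monotone in
  -- i on all of ℕ, as T ≥ 1.
  have hnorm : ∀ i ≤ k, fockNorm (fun z => z ^ i * g z) ≤ T ^ i * (√(π * N) / T ^ k) := by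
    intro i hi
    have h1 := ((hasSum_mass_pow_mul_iff hgd i _).1 (hgi i hi).summable.hasSum)
    have h2 : T ^ (2 * (k - i)) * ∑' n, mass (fun z => z ^ i * g z) n ≤ N := by
      refine hasSum_le (fun n => ?_) (h1.mul_left _) hSs.hasSum
      rw [← mul_assoc]
      exact mul_le_mul_of_nonneg_right (pow_mul_ascFactorial_le_eigen hi hT0.le n) (mass_nonneg g n)
    have h3 : T ^ i * (√(π * N) / T ^ k) = √(π * N) / T ^ (k - i) := by
      rw [← pow_sub_mul_pow T hi]
      field_simp
    rw [h3, le_div_iff₀ (by positivity)]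
    refine Real.le_sqrt_of_sq_le ?_
    rw [mul_pow, fockNorm_sq, ← pow_mul, mul_comm (k - i) 2]
    nlinarith [Real.pi_pos]
  set V : ℂ → ℂ := fun z => (W z : ℂ) with hVdef
  have hVs : ContDiff ℝ ∞ V := ofRealCLM.contDiff.comp hW
  have hVc := hVs.continuous
  have hVA : ∀ z, ‖V z‖ ≤ A := hA 0 (by omega)
  have hlN0 : 0 ≤ ∑' n, cutoff k T l n * mass f n := le_trans (by positivity) hlN
  -- The leading term ⟨z^k g, V z^k g⟩ is real, so only the errors remain; they pair a norm of size
  -- T⁻¹√(πN) with one of size √(πN).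
  have hgh : |(fockForm V g h).im| ≤ 2 ^ k * (A / T) * (π * N) := by
    have hs : (fockForm V (fun z => z ^ k * g z) (fun z => z ^ k * g z)).im = 0 :=
      fockForm_self_im W _
    have hν : Monotone fun i : ℕ => T ^ i * (√(π * N) / T ^ k) := fun i j hij => by
      have := pow_le_pow_right₀ hT hij
      simp only
      gcongr
    have hb := (fockForm_iterate_deriv hgi hgk hν hnorm hA0 k hVs hA (i := 0) (by omega)).2
    simp only [pow_zero, one_mul, zero_add] at hb
    have h1 : |(fockForm V g h).im| ≤
        (2 ^ k - 1) * (A * (T ^ (k - 1) * (√(π * N) / T ^ k)) * fockNorm fun z => z ^ k * g z) := by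
      refine le_trans ?_ hb
      have := Complex.abs_im_le_norm
        (fockForm V g h - fockForm V (fun z => z ^ k * g z) (fun z => z ^ k * g z))
      rwa [sub_im, hs, sub_zero] at this
    refine h1.trans ?_
    have hk := hnorm k le_rfl
    rw [mul_div_cancel₀ _ (by positivity)] at hk
    -- For k = 0 there is no error term, and T^(k-1) would not supply the factor 1/T.
    rcases Nat.eq_zero_or_pos k with rfl | hkpos
    · simp only [pow_zero, sub_self, zero_mul, one_mul]
      positivity
    · have e : A * (T ^ (k - 1) * (√(π * N) / T ^ k)) = A / T * √(π * N) := by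
        rw [← pow_sub_mul_pow T hkpos, pow_one]
        field_simp
      have e2 : √(π * N) * √(π * N) = π * N := Real.mul_self_sqrt (by positivity)
      have hf0 := fockNorm_nonneg fun z => z ^ k * g z
      rw [e]
      calc _ ≤ 2 ^ k * (A / T * √(π * N) * √(π * N)) := by
            gcongr
            linarith
        _ = 2 ^ k * (A / T) * (√(π * N) * √(π * N)) := by ring
        _ = _ := by rw [e2]
  have hgf : (fockForm V g f).im = (fockForm V g h).im := by
    have hc : ((l : ℂ) + (T : ℂ) ^ (2 * k)) = ((l + T ^ (2 * k) : ℝ) : ℂ) := by push_cast; rfl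
    rw [hfg, fockForm_add_const_mul_right hVc hVA hhs hgs hgs, hc, add_im, im_ofReal_mul,
      fockForm_self_im W, mul_zero, add_zero]
  -- w = f - l g = S/(l+S) f is an admissible test function: pairing it with v = Π(Wf) is pairing it
  -- with Wf, and ⟨f, Wf⟩ is real.
  set w : ℂ → ℂ := fun z => f z + (-(l : ℂ)) * g z with hw
  have hws : IsFockSymbol w := hf.add_const_mul hgs _
  have hwf : (fockForm V w f).im = -(l * (fockForm V g h).im) := by
    have hc : conj (-(l : ℂ)) = ((-l : ℝ) : ℂ) := by simp
    rw [hw, fockForm_add_const_mul_left hVc hVA hf hgs hf, hc, add_im, im_ofReal_mul,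
      fockForm_self_im W, hgf]
    ring
  have hwv : ∫ z, conj (toFock w z) * toFock v z = fockForm V w f := by
    have h1 := hproj w hws
    simp_rw [mul_sub] at h1
    have i1 : Integrable fun z => conj (toFock w z) * (V z * toFock f z) :=
      (integrable_fockForm hVc hVA hws hf).congr (Eventually.of_forall fun z => by ring)
    rw [integral_sub i1 (integrable_conj_toFock_mul hws hv), sub_eq_zero] at h1
    rw [← h1, fockForm]
    exact integral_congr_ae (Eventually.of_forall fun z => by ring)
  have hsum := (hasSum_integral_conj_toFock_mul hws.differentiable hv.differentiable
    hws.summable hv.summable).tsum_eq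
  have hcw : ∀ n, coef w n = cutoff k T l n * coef f n := fun n => by
    rw [hw, coef_add_const_mul hf.differentiable hgd, hg, cutoff, ← hS]
    have := hlSc n
    push_cast
    field_simp
    ring
  have hD : (π : ℂ) * ∑' n, (cutoff k T l n : ℂ) * (conj (coef f n) * coef v n / n !) =
      fockForm V w f := by
    rw [← hwv, ← hsum, ← tsum_mul_left]
    refine tsum_congr fun n => ?_
    rw [hcw, map_mul, conj_ofReal]
    ring
  have hDim := congrArg Complex.im hD
  rw [im_ofReal_mul, hwf] at hDim
  refine le_of_mul_le_mul_left ?_ Real.pi_pos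
  rw [← abs_of_pos Real.pi_pos, ← abs_mul, hDim, abs_neg, abs_mul, abs_of_pos hl,
    abs_of_pos Real.pi_pos]
  calc _ ≤ l * (2 ^ k * (A / T) * (π * N)) := by gcongr
    _ = π * (2 ^ k * (A / T) * (l * N)) := by ring
    _ ≤ _ := by gcongr

/-! ### The harmonic oscillator on the Bargmann-Fock space -/

theorem dzbar_mul {f g : ℂ → ℂ} {z : ℂ} (hf : DifferentiableAt ℝ f z)
    (hg : DifferentiableAt ℝ g z) :
    dzbar (fun w => f w * g w) z = dzbar f z * g z + f z * dzbar g z := by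
  simp only [dzbar, fderiv_fun_mul hf hg]
  simp
  ring

theorem dzbar_of_differentiable {f : ℂ → ℂ} {z : ℂ} (hf : DifferentiableAt ℂ f z) :
    dzbar f z = 0 := by
  have h : HasFDerivAt f _ z := hf.hasDerivAt.complexToReal_fderiv
  rw [dzbar, h.fderiv]
  simp
  ring_nf
  simp

theorem exp_neg_norm_sq_half (z : ℂ) :
    (Real.exp (-‖z‖ ^ 2 / 2) : ℂ) = Complex.exp (-(z * conj z) / 2) := by
  rw [Complex.mul_conj, Complex.normSq_eq_norm_sq]
  push_cast
  rfl

theorem hasFDerivAt_gaussian_half (z : ℂ) :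
    HasFDerivAt (fun w : ℂ => (Real.exp (-‖w‖ ^ 2 / 2) : ℂ))
      ((Real.exp (-‖z‖ ^ 2 / 2) : ℂ) • (-(2⁻¹ : ℂ)) •
        (z • (conjCLE : ℂ →L[ℝ] ℂ) + conj z • ContinuousLinearMap.id ℝ ℂ)) z := by
  simp_rw [exp_neg_norm_sq_half]
  have h1 : HasFDerivAt (fun w : ℂ => w) (ContinuousLinearMap.id ℝ ℂ) z := hasFDerivAt_id z
  have h2 : HasFDerivAt (fun w : ℂ => conj w) (conjCLE : ℂ →L[ℝ] ℂ) z :=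
    (conjCLE : ℂ →L[ℝ] ℂ).hasFDerivAt
  have h3 := ((h1.fun_mul h2).const_mul (-(2⁻¹ : ℂ))).cexp
  have e : ∀ w : ℂ, -(2⁻¹ : ℂ) * (w * conj w) = -(w * conj w) / 2 := fun w => by ring
  simpa only [e] using h3

theorem dz_gaussian_half (z : ℂ) :
    dz (fun w => (Real.exp (-‖w‖ ^ 2 / 2) : ℂ)) z =
      -(conj z / 2) * (Real.exp (-‖z‖ ^ 2 / 2) : ℂ) := by
  rw [dz, (hasFDerivAt_gaussian_half z).fderiv]
  simp
  ring_nf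
  simp
  ring

theorem dzbar_gaussian_half (z : ℂ) :
    dzbar (fun w => (Real.exp (-‖w‖ ^ 2 / 2) : ℂ)) z =
      -(z / 2) * (Real.exp (-‖z‖ ^ 2 / 2) : ℂ) := by
  rw [dzbar, (hasFDerivAt_gaussian_half z).fderiv]
  simp
  ring_nf
  simp
  ring

/-- On symbols H becomes 2(1 + z∂), hence is diagonal with eigenvalues 2(n+1). -/
theorem harmonicOsc_toFock {f : ℂ → ℂ} (hf : Differentiable ℂ f) :
    harmonicOsc (toFock f) = toFock fun z => 2 * f z + 2 * (z * deriv f z) := by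
  have hr : Differentiable ℝ f := hf.restrictScalars ℝ
  have he : ∀ z : ℂ, DifferentiableAt ℝ (fun w : ℂ => (Real.exp (-‖w‖ ^ 2 / 2) : ℂ)) z :=
    fun z => (hasFDerivAt_gaussian_half z).differentiableAt
  have h1 : dzbar (toFock f) = fun z => -(z / 2) * toFock f z := by
    ext z
    unfold toFock
    rw [dzbar_mul (hr z) (he z), dzbar_of_differentiable (hf z), dzbar_gaussian_half]
    ring
  ext z
  have hl : Differentiable ℂ fun w : ℂ => -(w / 2) := by fun_prop
  have hl' : deriv (fun w : ℂ => -(w / 2)) z = -(1 / 2) := by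
    simp
  have hn : (‖z‖ : ℂ) ^ 2 = z * conj z := by
    rw [Complex.mul_conj, Complex.normSq_eq_norm_sq]; push_cast; rfl
  rw [harmonicOsc, h1]
  unfold toFock
  rw [dz_mul (hl.restrictScalars ℝ z) ((hr z).fun_mul (he z)), dz_of_differentiable (hl z), hl',
    dz_mul (hr z) (he z), dz_of_differentiable (hf z), dz_gaussian_half, hn]
  ring

/-- The entire function associated with an element of the Bargmann-Fock space. -/
def symbol (u : ℂ → ℂ) (z : ℂ) : ℂ := u z * (Real.exp (‖z‖ ^ 2 / 2) : ℂ)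

theorem symbol_toFock (f : ℂ → ℂ) : symbol (toFock f) = f := by
  ext z
  rw [symbol, toFock, mul_assoc, ← ofReal_mul, ← Real.exp_add]
  ring_nf
  simp

theorem toFock_symbol (u : ℂ → ℂ) : toFock (symbol u) = u := by
  ext z
  rw [toFock, symbol, mul_assoc, ← ofReal_mul, ← Real.exp_add]
  ring_nf
  simp

theorem isFockSymbol_symbol {u : ℂ → ℂ} (hu : u ∈ fock) : IsFockSymbol (symbol u) := by
  obtain ⟨⟨f, hf, hfu⟩, hm⟩ := hu
  have : u = toFock f := funext hfu
  rw [this, symbol_toFock]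
  rw [this] at hm
  exact ⟨hf, (memLp_toFock_iff hf).1 hm⟩

theorem IsFockSymbol.mem_fock {f : ℂ → ℂ} (hf : IsFockSymbol f) : toFock f ∈ fock :=
  ⟨⟨f, hf.differentiable, fun _ => rfl⟩, hf.memLp⟩

/-! ### Pointwise bounds and Cauchy's formula -/

/-- Cauchy's formula reduces time derivatives of coefficients to pointwise ones by differentiation
under the integral. -/
theorem coef_eq_circleIntegral {f : ℂ → ℂ} (hf : Differentiable ℂ f) (n : ℕ) :
    coef f n = n ! * ((2 * π * I)⁻¹ * ∮ z in C(0, 1), (1 / z) ^ n * (z⁻¹ * f z)) := by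
  have h := (hf.differentiableOn (s := Metric.closedBall 0 ((1 : NNReal) : ℝ))).hasFPowerSeriesOnBall
    one_pos
  rw [coef, iteratedDeriv_eq_iteratedFDeriv, ← h.factorial_smul (1 : ℂ) n, cauchyPowerSeries_apply]
  simp

theorem summable_four_pow_div : Summable fun n : ℕ => (4 : ℝ) ^ n / n ! :=
  Real.summable_pow_div_factorial 4

/-- Young's inequality and (n+1)² ≤ 4^n: the factor n+1 coming from H is absorbed by the factorial,
so the L² norm alone suffices. -/
theorem add_one_mul_coef_le {f : ℂ → ℂ} (n : ℕ) :
    (n + 1) * ‖coef f n‖ / n ! ≤ mass f n + (4 : ℝ) ^ n / n ! := by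
  have h1 : (n : ℝ) + 1 ≤ 2 ^ n := by exact_mod_cast Nat.lt_two_pow_self
  have h2 : ((n : ℝ) + 1) ^ 2 ≤ 4 ^ n := by
    calc ((n : ℝ) + 1) ^ 2 ≤ (2 ^ n) ^ 2 := by gcongr
      _ = 4 ^ n := by rw [← pow_mul, mul_comm, pow_mul]; norm_num
  rw [mass, ← add_div]
  gcongr
  nlinarith [sq_nonneg ((n : ℝ) + 1 - ‖coef f n‖), sq_nonneg ((n : ℝ) + 1), sq_nonneg ‖coef f n‖]

/-- A bound on the unit disc for an entire function whose Taylor coefficients are dominated by those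
of `f + z f'` and `g`. -/
theorem norm_le_tsum_mass {f K : ℂ → ℂ} {g : ℂ → ℂ} (hf : IsFockSymbol f) (hg : IsFockSymbol g)
    (hK : Differentiable ℂ K) {a : ℝ}
    (h : ∀ n : ℕ, ‖coef K n‖ ≤ a * ((n + 1) * ‖coef f n‖) + ‖coef g n‖) {z : ℂ} (ha : 0 ≤ a)
    (hz : ‖z‖ ≤ 1) :
    ‖K z‖ ≤ a * (∑' n, mass f n + ∑' n : ℕ, (4 : ℝ) ^ n / n !) +
      (∑' n, mass g n + ∑' n : ℕ, (4 : ℝ) ^ n / n !) := by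
  have h4 := summable_four_pow_div
  have hs := ((hf.summable.hasSum.add h4.hasSum).mul_left a).add (hg.summable.hasSum.add h4.hasSum)
  have hK' := hasSum_coef hK z
  rw [← hK'.tsum_eq]
  refine tsum_of_norm_bounded hs fun n => ?_
  have h1 := add_one_mul_coef_le (f := f) n
  have h2 := add_one_mul_coef_le (f := g) n
  have h3 : ‖coef g n‖ / n ! ≤ (n + 1) * ‖coef g n‖ / n ! := by
    gcongr
    exact le_mul_of_one_le_left (norm_nonneg _) (by linarith [(Nat.cast_nonneg n : (0 : ℝ) ≤ n)])
  rw [norm_mul, norm_div, Complex.norm_natCast, norm_pow]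
  calc ‖coef K n‖ / n ! * ‖z‖ ^ n ≤ ‖coef K n‖ / n ! * 1 := by
        gcongr
        exact pow_le_one₀ (norm_nonneg _) hz
    _ ≤ (a * ((n + 1) * ‖coef f n‖) + ‖coef g n‖) / n ! := by rw [mul_one]; gcongr; exact h n
    _ = a * ((n + 1) * ‖coef f n‖ / n !) + ‖coef g n‖ / n ! := by ring
    _ ≤ _ := by gcongr; exact h3.trans h2

/-- Differentiation of Taylor coefficients with respect to a parameter. -/
theorem hasDerivAt_coef {F K : ℝ → ℂ → ℂ} (hF : ∀ t, Differentiable ℂ (F t))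
    (hK : ∀ t, Differentiable ℂ (K t)) (hd : ∀ t z, HasDerivAt (fun τ => F τ z) (K t z) t)
    {t : ℝ} {s : Set ℝ} (hs : s ∈ 𝓝 t) {B : ℝ} (hB : ∀ τ ∈ s, ∀ z, ‖z‖ ≤ 1 → ‖K τ z‖ ≤ B) (n : ℕ) :
    HasDerivAt (fun τ => coef (F τ) n) (coef (K t) n) t := by
  simp_rw [coef_eq_circleIntegral (hF _), coef_eq_circleIntegral (hK _)]
  refine HasDerivAt.const_mul _ (HasDerivAt.const_mul _ ?_)
  have hc := continuous_circleMap 0 1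
  have hne : ∀ θ : ℝ, circleMap 0 1 θ ≠ 0 := fun θ => circleMap_ne_center one_ne_zero
  have hcont : ∀ g : ℂ → ℂ, Differentiable ℂ g → Continuous fun θ : ℝ =>
      deriv (circleMap 0 1) θ • ((1 / circleMap 0 1 θ) ^ n * ((circleMap 0 1 θ)⁻¹ *
        g (circleMap 0 1 θ))) := by
    intro g hg
    have := hg.continuous
    simp only [deriv_circleMap]
    have h1 : Continuous fun θ : ℝ => (circleMap 0 1 θ)⁻¹ := hc.inv₀ hne
    simp only [one_div]
    fun_prop
  refine (intervalIntegral.hasDerivAt_integral_of_dominated_loc_of_deriv_le (μ := volume)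
    (F := fun τ θ => deriv (circleMap 0 1) θ • ((1 / circleMap 0 1 θ) ^ n *
      ((circleMap 0 1 θ)⁻¹ * F τ (circleMap 0 1 θ))))
    (F' := fun τ θ => deriv (circleMap 0 1) θ • ((1 / circleMap 0 1 θ) ^ n *
      ((circleMap 0 1 θ)⁻¹ * K τ (circleMap 0 1 θ)))) (bound := fun _ => B) hs
    (Eventually.of_forall fun τ => (hcont _ (hF τ)).aestronglyMeasurable)
    ((hcont _ (hF t)).intervalIntegrable _ _) (hcont _ (hK t)).aestronglyMeasurable ?_
    intervalIntegrable_const ?_).2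
  · refine Eventually.of_forall fun θ _ τ hτ => ?_
    simpa using hB τ hτ (circleMap 0 1 θ) (by simp)
  · refine Eventually.of_forall fun θ _ τ hτ => ?_
    exact (((hd τ _).const_mul _).const_mul _).const_mul _

/-! ### Evolution of the Taylor coefficients -/

/-- D is only integrable, so E need not be differentiable; the argument runs on the C¹ majorant p
obtained by integrating K E. -/
theorem le_mul_exp_of_integral_eq_of_nonneg {E D : ℝ → ℝ} {K : ℝ} (hK : 0 ≤ K)
    (hD : ∀ a b, IntervalIntegrable D volume a b) (hE : ∀ t, E t = E 0 + ∫ τ in 0..t, D τ)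
    (h : ∀ t, D t ≤ K * E t) {t : ℝ} (ht : 0 ≤ t) : E t ≤ E 0 * Real.exp (K * t) := by
  have hEc : Continuous E := by
    have : E = fun t => E 0 + ∫ τ in 0..t, D τ := funext hE
    rw [this]
    exact continuous_const.add (intervalIntegral.continuous_primitive hD 0)
  set p : ℝ → ℝ := fun t => E 0 + ∫ τ in 0..t, K * E τ with hp
  have hpd : ∀ t, HasDerivAt p (K * E t) t := fun t =>
    ((hEc.const_mul K).integral_hasStrictDerivAt 0 t).hasDerivAt.const_add _
  have hEp : ∀ t, 0 ≤ t → E t ≤ p t := fun t ht => by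
    rw [hE t]
    exact add_le_add_right (intervalIntegral.integral_mono_on ht (hD 0 t)
      ((hEc.const_mul K).intervalIntegrable _ _) fun τ _ => h τ) _
  set q : ℝ → ℝ := fun t => p t * Real.exp (-(K * t)) with hq
  have hqd : ∀ t, HasDerivAt q (K * E t * Real.exp (-(K * t)) +
      p t * (Real.exp (-(K * t)) * -(K * 1))) t := fun t =>
    (hpd t).mul (((hasDerivAt_id t).const_mul K).neg.exp)
  have hanti : AntitoneOn q (Set.Ici 0) := by
    refine antitoneOn_of_deriv_nonpos (convex_Ici 0)
      (fun t _ => (hqd t).continuousAt.continuousWithinAt)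
      (fun t _ => (hqd t).differentiableAt.differentiableWithinAt) fun t ht => ?_
    rw [interior_Ici] at ht
    rw [(hqd t).deriv]
    have h1 := hEp t (le_of_lt ht)
    have h2 := Real.exp_pos (-(K * t))
    have : K * (E t - p t) * Real.exp (-(K * t)) ≤ 0 :=
      mul_nonpos_of_nonpos_of_nonneg (mul_nonpos_of_nonneg_of_nonpos hK (by linarith)) h2.le
    linarith
  have h1 : q t ≤ q 0 := hanti (Set.self_mem_Ici) ht ht
  have h0 : q 0 = E 0 := by simp [hq, hp]
  calc E t ≤ p t := hEp t ht
    _ = q t * Real.exp (K * t) := by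
      rw [hq, mul_assoc, ← Real.exp_add]; simp
    _ ≤ E 0 * Real.exp (K * t) := by rw [← h0]; gcongr

/-- Grönwall's inequality in integral form, forwards and backwards in time. -/
theorem le_mul_exp_of_integral_eq {E D : ℝ → ℝ} {K : ℝ} (hK : 0 ≤ K)
    (hD : ∀ a b, IntervalIntegrable D volume a b) (hE : ∀ t, E t = E 0 + ∫ τ in 0..t, D τ)
    (h : ∀ t, |D t| ≤ K * E t) (t : ℝ) : E t ≤ E 0 * Real.exp (K * |t|) := by
  rcases le_total 0 t with ht | ht
  · rw [abs_of_nonneg ht]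
    exact le_mul_exp_of_integral_eq_of_nonneg hK hD hE (fun t => (le_abs_self _).trans (h t)) ht
  · rw [abs_of_nonpos ht]
    have := le_mul_exp_of_integral_eq_of_nonneg (E := fun t => E (-t)) (D := fun t => -D (-t)) hK
      (fun a b => by
        have : IntervalIntegrable (fun x => D (-x)) volume a b := by
          simpa using (hD (-a) (-b)).comp_sub_left 0
        exact this.neg) (fun t => ?_)
      (fun t => (neg_le_abs _).trans (h (-t))) (t := -t) (by linarith)
    · simpa using this
    · simp only [intervalIntegral.integral_neg, neg_zero]
      rw [hE (-t), intervalIntegral.integral_comp_neg, neg_zero, ← intervalIntegral.integral_symm]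

/-- Testing the projection against v itself gives ‖v‖² = ⟨v, Wf⟩, and Cauchy–Schwarz concludes. -/
theorem mass_le_of_proj {W : ℂ → ℝ} {A : ℝ} (hW : Continuous W) (hA : ∀ z, ‖(W z : ℂ)‖ ≤ A)
    {f v : ℂ → ℂ} (hf : IsFockSymbol f) (hv : IsFockSymbol v)
    (hproj : ∫ z, conj (toFock v z) * ((W z : ℂ) * toFock f z - toFock v z) = 0) :
    ∑' n, mass v n ≤ A ^ 2 * ∑' n, mass f n := by
  have hA0 : 0 ≤ A := (norm_nonneg _).trans (hA 0)
  have hVc : Continuous fun z => (W z : ℂ) := by fun_prop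
  have e : fockForm (fun z => (W z : ℂ)) v f = ((fockNorm v ^ 2 : ℝ) : ℂ) := by
    simp_rw [mul_sub] at hproj
    have i1 : Integrable fun z => conj (toFock v z) * ((W z : ℂ) * toFock f z) :=
      (integrable_fockForm hVc hA hv hf).congr (Eventually.of_forall fun z => by ring)
    rw [integral_sub i1 (integrable_conj_toFock_mul hv hv), sub_eq_zero] at hproj
    rw [fockNorm_sq, ← integral_toFock_sq hv.differentiable hv.summable, ← integral_complex_ofReal]
    calc _ = _ := integral_congr_ae (Eventually.of_forall fun z => by ring)
      _ = _ := hproj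
      _ = _ := integral_congr_ae (Eventually.of_forall fun z => by
        simp only
        rw [Complex.conj_mul']
        push_cast
        rfl)
  have h1 := norm_fockForm_le hA hv hf
  rw [e, norm_real, Real.norm_of_nonneg (sq_nonneg _)] at h1
  have h2 : fockNorm v ≤ A * fockNorm f := by
    rcases (fockNorm_nonneg v).eq_or_lt with h0 | h0
    · rw [← h0]
      exact mul_nonneg hA0 (fockNorm_nonneg f)
    · refine le_of_mul_le_mul_right ?_ h0
      nlinarith
  have h3 : fockNorm v ^ 2 ≤ (A * fockNorm f) ^ 2 := pow_le_pow_left₀ (fockNorm_nonneg v) h2 2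
  rw [mul_pow, fockNorm_sq, fockNorm_sq] at h3
  refine le_of_mul_le_mul_left ?_ Real.pi_pos
  linarith

theorem IsSolution.continuous_mass {δ : ℝ} {W : ℝ → ℂ → ℝ} {u₀ : ℂ → ℂ} {u : ℝ → ℂ → ℂ}
    (hu : IsSolution δ W u₀ u) : Continuous fun t => ∑' n, mass (symbol (u t)) n := by
  have hm : ∀ t, MemLp (u t) 2 volume := fun t => (hu.mem t).2
  have h1 : Continuous fun t => (hm t).toLp (u t) := by
    rw [continuous_iff_continuousAt]
    intro t
    rw [ContinuousAt, Lp.tendsto_Lp_iff_tendsto_eLpNorm'' _ hm _ (hm t)]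
    exact hu.continuous t
  have h2 : ∀ t, ∑' n, mass (symbol (u t)) n = π⁻¹ * ‖(hm t).toLp (u t)‖ ^ 2 := by
    intro t
    have hs := isFockSymbol_symbol (hu.mem t)
    have h := eLpNorm_toFock_sq hs.differentiable
    rw [toFock_symbol, ← ENNReal.ofReal_tsum_of_nonneg (mass_nonneg _) hs.summable] at h
    rw [Lp.norm_toLp, ← ENNReal.toReal_pow, h, ENNReal.toReal_mul,
      ENNReal.toReal_ofReal Real.pi_pos.le, ENNReal.toReal_ofReal (tsum_nonneg (mass_nonneg _)),
      inv_mul_cancel_left₀ Real.pi_ne_zero]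
  simp_rw [h2]
  fun_prop

/-- The right-hand side `Π (W u)` of the equation. -/
def forcing (δ : ℝ) (u : ℝ → ℂ → ℂ) (t : ℝ) (z : ℂ) : ℂ :=
  I * deriv (fun τ => u τ z) t - (δ : ℂ) * harmonicOsc (u t) z

section

variable {δ : ℝ} {W : ℝ → ℂ → ℝ} {u₀ : ℂ → ℂ} {u : ℝ → ℂ → ℂ}

theorem IsSolution.isFockSymbol (hu : IsSolution δ W u₀ u) (t : ℝ) : IsFockSymbol (symbol (u t)) :=
  isFockSymbol_symbol (hu.mem t)

theorem IsSolution.isFockSymbol_forcing (hu : IsSolution δ W u₀ u) (t : ℝ) :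
    IsFockSymbol (symbol (forcing δ u t)) :=
  isFockSymbol_symbol (hu.equation t).2.1

theorem IsSolution.proj (hu : IsSolution δ W u₀ u) (t : ℝ) {w : ℂ → ℂ} (hw : IsFockSymbol w) :
    ∫ z, conj (toFock w z) * ((W t z : ℂ) * toFock (symbol (u t)) z -
      toFock (symbol (forcing δ u t)) z) = 0 := by
  rw [toFock_symbol, toFock_symbol]
  exact (hu.equation t).2.2 _ hw.mem_fock

/-- The symbol of the time derivative of a solution. -/
def velocity (δ : ℝ) (u : ℝ → ℂ → ℂ) (t : ℝ) (z : ℂ) : ℂ :=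
  -I * (δ * (2 * symbol (u t) z + 2 * (z * deriv (symbol (u t)) z)) + symbol (forcing δ u t) z)

theorem IsSolution.differentiable_velocity (hu : IsSolution δ W u₀ u) (t : ℝ) :
    Differentiable ℂ (velocity δ u t) := by
  have h1 := (hu.isFockSymbol t).differentiable
  have h2 := h1.deriv
  have h3 := (hu.isFockSymbol_forcing t).differentiable
  unfold velocity
  fun_prop

theorem IsSolution.hasDerivAt_symbol (hu : IsSolution δ W u₀ u) (t : ℝ) (z : ℂ) :
    HasDerivAt (fun τ => symbol (u τ) z) (velocity δ u t z) t := by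
  have h := (hu.differentiable z t).hasDerivAt.mul_const ((Real.exp (‖z‖ ^ 2 / 2) : ℂ))
  convert! h using 1
  have h1 := (hu.isFockSymbol t).differentiable
  have h2 : harmonicOsc (u t) = toFock fun z =>
      2 * symbol (u t) z + 2 * (z * deriv (symbol (u t)) z) := by
    rw [← harmonicOsc_toFock h1, toFock_symbol]
  have h3 : symbol (harmonicOsc (u t)) z =
      2 * symbol (u t) z + 2 * (z * deriv (symbol (u t)) z) := by rw [h2, symbol_toFock]
  rw [velocity, ← h3]
  simp only [symbol, forcing]
  ring_nf
  simp

theorem IsSolution.coef_velocity (hu : IsSolution δ W u₀ u) (t : ℝ) (n : ℕ) :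
    coef (velocity δ u t) n = -I * (2 * δ * (n + 1) * coef (symbol (u t)) n +
      coef (symbol (forcing δ u t)) n) := by
  have h1 := (hu.isFockSymbol t).differentiable
  have h2 := h1.deriv
  have h3 := (hu.isFockSymbol_forcing t).differentiable
  have h4 : coef (fun z => z * deriv (symbol (u t)) z) n = n * coef (symbol (u t)) n := by
    cases n with
    | zero => simp [coef_id_mul_zero]
    | succ n => rw [coef_id_mul_succ h2, coef_deriv]; push_cast; rfl
  unfold velocity
  rw [coef_const_mul (by fun_prop), coef_add (by fun_prop) h3, coef_const_mul (by fun_prop),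
    coef_add (by fun_prop) (by fun_prop), coef_const_mul h1, coef_const_mul (by fun_prop), h4]
  ring

/-- Continuity in 𝓔 bounds the L² norm on [t-1, t+1], hence the velocity uniformly on the unit disc,
which is the domination required. -/
theorem IsSolution.hasDerivAt_coef (hu : IsSolution δ W u₀ u) (hW : ∀ t, Continuous (W t)) {A : ℝ}
    (hA : ∀ t z, ‖(W t z : ℂ)‖ ≤ A) (t : ℝ) (n : ℕ) :
    HasDerivAt (fun τ => coef (symbol (u τ)) n) (coef (velocity δ u t) n) t := by
  have hm := hu.continuous_mass
  obtain ⟨M, hM⟩ := (isCompact_Icc (a := t - 1) (b := t + 1)).exists_bound_of_continuousOn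
    hm.continuousOn
  refine LLL.hasDerivAt_coef (fun t => (hu.isFockSymbol t).differentiable)
    hu.differentiable_velocity hu.hasDerivAt_symbol (s := Set.Icc (t - 1) (t + 1))
    (Icc_mem_nhds (by linarith) (by linarith))
    (B := 2 * |δ| * (M + ∑' n : ℕ, (4 : ℝ) ^ n / n !) +
      (A ^ 2 * M + ∑' n : ℕ, (4 : ℝ) ^ n / n !)) (fun τ hτ z hz => ?_) n
  have h1 := norm_le_tsum_mass (hu.isFockSymbol τ) (hu.isFockSymbol_forcing τ)
    (hu.differentiable_velocity τ) (a := 2 * |δ|) (fun n => ?_) (by positivity) hz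
  · have h2 := mass_le_of_proj (hW τ) (hA τ) (hu.isFockSymbol τ) (hu.isFockSymbol_forcing τ)
      (hu.proj τ (hu.isFockSymbol_forcing τ))
    have h3 := (le_abs_self _).trans (hM τ hτ)
    refine h1.trans ?_
    have : ∑' n, mass (symbol (forcing δ u τ)) n ≤ A ^ 2 * M := h2.trans (by gcongr)
    gcongr
  · rw [hu.coef_velocity, norm_mul, norm_neg, norm_I, one_mul]
    refine (norm_add_le _ _).trans (add_le_add_left (le_of_eq ?_) _)
    have : ‖((n : ℂ) + 1)‖ = n + 1 := by exact_mod_cast Complex.norm_natCast (n + 1)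
    rw [norm_mul, norm_mul, norm_mul, this, norm_real, Real.norm_eq_abs]
    simp
    ring

/-- The density of the energy flux in the `n`-th mode. -/
def flux (f v : ℂ → ℂ) (n : ℕ) : ℝ := 2 * (conj (coef f n) * coef v n / n !).im

theorem abs_flux_le (f v : ℂ → ℂ) (n : ℕ) : |flux f v n| ≤ mass f n + mass v n := by
  have h := Complex.abs_im_le_norm (conj (coef f n) * coef v n / n !)
  rw [norm_div, norm_mul, RCLike.norm_conj, Complex.norm_natCast] at h
  rw [flux, abs_mul, abs_two, mass, mass, ← add_div]
  calc 2 * |(conj (coef f n) * coef v n / n !).im| ≤ 2 * (‖coef f n‖ * ‖coef v n‖ / n !) := by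
        gcongr
    _ = 2 * (‖coef f n‖ * ‖coef v n‖) / n ! := by ring
    _ ≤ _ := by gcongr; nlinarith [sq_nonneg (‖coef f n‖ - ‖coef v n‖)]

/-- The contribution of δH to the derivative of the coefficient is -i times a real multiple of that
coefficient, so it does not change the modulus. -/
theorem IsSolution.hasDerivAt_mass (hu : IsSolution δ W u₀ u) (hW : ∀ t, Continuous (W t)) {A : ℝ}
    (hA : ∀ t z, ‖(W t z : ℂ)‖ ≤ A) (t : ℝ) (n : ℕ) :
    HasDerivAt (fun τ => mass (symbol (u τ)) n)
      (flux (symbol (u t)) (symbol (forcing δ u t)) n) t := by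
  have h := (hu.hasDerivAt_coef hW hA t n).norm_sq.div_const (n ! : ℝ)
  convert! h using 1
  rw [hu.coef_velocity, flux, Complex.inner]
  simp
  ring

/-- Weights in [0,1] make every series converge from L² information alone. The energy identity is
proved for finite sums of modes and passed to the limit in integrated form, dominated by a
continuous function of time. -/
theorem IsSolution.cutoff_energy_le (hu : IsSolution δ W u₀ u) {k : ℕ} {T l A : ℝ} (hT : 1 ≤ T)
    (hl : 0 < l) (hW : ∀ t, ContDiff ℝ ∞ (W t))
    (hA : ∀ t, ∀ j ≤ k, ∀ z, ‖dz^[j] (fun z => (W t z : ℂ)) z‖ ≤ A) (t : ℝ) :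
    ∑' n, cutoff k T l n * mass (symbol (u t)) n ≤
      (∑' n, cutoff k T l n * mass (symbol (u 0)) n) *
        Real.exp (2 * (2 ^ k * (A / T)) * |t|) := by
  have hA0 : ∀ t z, ‖(W t z : ℂ)‖ ≤ A := fun t z => hA t 0 (by omega) z
  have hWc : ∀ t, Continuous (W t) := fun t => (hW t).continuous
  have hAn : 0 ≤ A := (norm_nonneg _).trans (hA0 0 0)
  have hT0 : 0 < T := by linarith
  set q := cutoff k T l with hq
  have hq0 := cutoff_nonneg k T hl
  have hq1 := cutoff_le_one k T hl
  set f : ℝ → ℂ → ℂ := fun t => symbol (u t) with hf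
  set v : ℝ → ℂ → ℂ := fun t => symbol (forcing δ u t) with hv
  have hfs := hu.isFockSymbol
  have hvs := hu.isFockSymbol_forcing
  have hqf : ∀ t, Summable fun n => q n * mass (f t) n := fun t =>
    (hfs t).summable.of_nonneg_of_le (fun n => mul_nonneg (hq0 n) (mass_nonneg _ n))
      fun n => mul_le_of_le_one_left (mass_nonneg _ n) (hq1 n)
  have hqle : ∀ t n, |q n * flux (f t) (v t) n| ≤ mass (f t) n + mass (v t) n := fun t n => by
    rw [abs_mul, abs_of_nonneg (hq0 n)]
    exact (mul_le_of_le_one_left (abs_nonneg _) (hq1 n)).trans (abs_flux_le _ _ n)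
  have hqD : ∀ t, Summable fun n => q n * flux (f t) (v t) n := fun t =>
    Summable.of_norm_bounded ((hfs t).summable.add (hvs t).summable) (hqle t)
  have hmv : ∀ t, ∑' n, mass (v t) n ≤ A ^ 2 * ∑' n, mass (f t) n := fun t =>
    mass_le_of_proj (hWc t) (hA0 t) (hfs t) (hvs t) (hu.proj t (hvs t))
  set m : ℝ → ℝ := fun t => (1 + A ^ 2) * ∑' n, mass (f t) n with hm
  have hmc : Continuous m := hu.continuous_mass.const_mul _
  set DN : ℕ → ℝ → ℝ := fun N t => ∑ n ∈ Finset.range N, q n * flux (f t) (v t) n with hDN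
  set D : ℝ → ℝ := fun t => ∑' n, q n * flux (f t) (v t) n with hD
  have hDNle : ∀ N t, |DN N t| ≤ m t := fun N t => by
    calc |DN N t| ≤ ∑ n ∈ Finset.range N, (mass (f t) n + mass (v t) n) :=
          (Finset.abs_sum_le_sum_abs _ _).trans (Finset.sum_le_sum fun n _ => hqle t n)
      _ ≤ ∑' n, (mass (f t) n + mass (v t) n) :=
          ((hfs t).summable.add (hvs t).summable).sum_le_tsum _ fun n _ =>
            add_nonneg (mass_nonneg _ _) (mass_nonneg _ _)
      _ ≤ m t := by
          rw [(hfs t).summable.tsum_add (hvs t).summable, hm]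
          have := hmv t
          simp only at this ⊢
          linarith
  have hENd : ∀ N t, HasDerivAt (fun t => ∑ n ∈ Finset.range N, q n * mass (f t) n) (DN N t) t :=
    fun N t => HasDerivAt.fun_sum fun n _ => (hu.hasDerivAt_mass hWc hA0 t n).const_mul (q n)
  -- No continuity in time of the forcing is established; the flux is measurable because it is a
  -- derivative.
  have hDNm : ∀ N, Measurable (DN N) := fun N => by
    have : DN N = deriv fun t => ∑ n ∈ Finset.range N, q n * mass (f t) n :=
      funext fun t => (hENd N t).deriv.symm
    rw [this]
    exact measurable_deriv _
  have hDNt : ∀ t, Tendsto (fun N => DN N t) atTop (𝓝 (D t)) := fun t =>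
    (hqD t).hasSum.tendsto_sum_nat
  have hDm : Measurable D := measurable_of_tendsto_metrizable hDNm (tendsto_pi_nhds.2 hDNt)
  have hDle : ∀ t, |D t| ≤ m t := fun t =>
    le_of_tendsto (hDNt t).abs (Eventually.of_forall fun N => hDNle N t)
  have hint : ∀ g : ℝ → ℝ, Measurable g → (∀ t, |g t| ≤ m t) → ∀ a b,
      IntervalIntegrable g volume a b := fun g hg hgm a b =>
    (hmc.intervalIntegrable a b).mono_fun' hg.aestronglyMeasurable (Eventually.of_forall hgm)
  have hE : ∀ t, ∑' n, q n * mass (f t) n = ∑' n, q n * mass (f 0) n + ∫ τ in 0..t, D τ := by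
    intro t
    have h1 : ∀ N, ∑ n ∈ Finset.range N, q n * mass (f t) n =
        ∑ n ∈ Finset.range N, q n * mass (f 0) n + ∫ τ in 0..t, DN N τ := fun N => by
      rw [intervalIntegral.integral_eq_sub_of_hasDerivAt (fun τ _ => hENd N τ)
        (hint _ (hDNm N) (hDNle N) 0 t)]
      ring
    refine tendsto_nhds_unique (hqf t).hasSum.tendsto_sum_nat ?_
    simp_rw [h1]
    refine (hqf 0).hasSum.tendsto_sum_nat.add ?_
    exact intervalIntegral.tendsto_integral_filter_of_dominated_convergence m
      (Eventually.of_forall fun N => (hDNm N).aestronglyMeasurable)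
      (Eventually.of_forall fun N => Eventually.of_forall fun τ _ => hDNle N τ)
      (hmc.intervalIntegrable 0 t) (Eventually.of_forall fun τ _ => hDNt τ)
  refine le_mul_exp_of_integral_eq (E := fun t => ∑' n, q n * mass (f t) n) (D := D)
    (by positivity) (hint D hDm hDle) hE (fun t => ?_) t
  have key := im_tsum_cutoff_le hT hl (hW t) (hA t) (hfs t) (hvs t) fun w hw => hu.proj t hw
  have hDt : D t = 2 * (∑' n, (q n : ℂ) * (conj (coef (f t) n) * coef (v t) n / n !)).im := by
    have hs : Summable fun n => (q n : ℂ) * (conj (coef (f t) n) * coef (v t) n / n !) := by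
      refine Summable.of_norm_bounded ((hfs t).summable.add (hvs t).summable) fun n => ?_
      rw [norm_mul, norm_real, Real.norm_of_nonneg (hq0 n), norm_div, norm_mul, RCLike.norm_conj,
        Complex.norm_natCast]
      refine (mul_le_of_le_one_left (by positivity) (hq1 n)).trans ?_
      rw [mass, mass, ← add_div]
      gcongr
      nlinarith [sq_nonneg (‖coef (f t) n‖ - ‖coef (v t) n‖), sq_nonneg ‖coef (f t) n‖,
        sq_nonneg ‖coef (v t) n‖]
    rw [Complex.im_tsum hs, ← tsum_mul_left]
    refine tsum_congr fun n => ?_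
    rw [im_ofReal_mul, flux]
    ring
  rw [hDt, abs_mul, abs_two]
  linarith

end

/-! ### Interpolation -/

/-- The endpoint θ = 1: l S/(l+S) ≤ S, with convergence to S as l → ∞. -/
theorem tsum_mul_le_of_cutoff {S : ℕ → ℝ} (hS : ∀ n, 0 < S n) {p q : ℕ → ℝ≥0∞} {K : ℝ≥0∞}
    (h : ∀ l : ℝ, 0 < l → ∑' n, ENNReal.ofReal (S n / (l + S n)) * p n ≤
      K * ∑' n, ENNReal.ofReal (S n / (l + S n)) * q n) :
    ∑' n, ENNReal.ofReal (S n) * p n ≤ K * ∑' n, ENNReal.ofReal (S n) * q n := by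
  refine ENNReal.tsum_le_of_sum_range_le fun N => ?_
  have hlim : Tendsto (fun l : ℝ => ∑ n ∈ Finset.range N,
      ENNReal.ofReal (l * (S n / (l + S n))) * p n) atTop
      (𝓝 (∑ n ∈ Finset.range N, ENNReal.ofReal (S n) * p n)) := by
    refine tendsto_finsetSum _ fun n _ => ENNReal.Tendsto.mul_const
      (ENNReal.tendsto_ofReal ?_) (Or.inl (by simp [hS n]))
    have h1 : Tendsto (fun l : ℝ => S n - S n * S n / (l + S n)) atTop (𝓝 (S n - 0)) :=
      tendsto_const_nhds.sub (tendsto_const_nhds.div_atTop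
        (tendsto_atTop_add_const_right _ _ tendsto_id))
    rw [sub_zero] at h1
    refine h1.congr' ?_
    filter_upwards [eventually_gt_atTop 0] with l hl
    have := hS n
    field_simp
    ring
  refine le_of_tendsto hlim ?_
  filter_upwards [eventually_gt_atTop 0] with l hl
  have hmul : ∀ n, ENNReal.ofReal (l * (S n / (l + S n))) =
      ENNReal.ofReal l * ENNReal.ofReal (S n / (l + S n)) := fun n => ENNReal.ofReal_mul hl.le
  calc _ ≤ ∑' n, ENNReal.ofReal (l * (S n / (l + S n))) * p n := ENNReal.sum_le_tsum _
    _ = ENNReal.ofReal l * ∑' n, ENNReal.ofReal (S n / (l + S n)) * p n := by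
      simp_rw [hmul, mul_assoc, ENNReal.tsum_mul_left]
    _ ≤ ENNReal.ofReal l * (K * ∑' n, ENNReal.ofReal (S n / (l + S n)) * q n) := by
      gcongr
      exact h l hl
    _ = K * ∑' n, ENNReal.ofReal (l * (S n / (l + S n))) * q n := by
      simp_rw [hmul, mul_assoc, ENNReal.tsum_mul_left]
      ring
    _ ≤ _ := by
      gcongr with n
      have := hS n
      rw [mul_div_assoc', div_le_iff₀ (by positivity)]
      nlinarith

theorem lintegral_rpowIntegrand {θ : ℝ} (hθ : θ ∈ Set.Ioo 0 1) {x : ℝ} (hx : 0 ≤ x) :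
    ∫⁻ t in Set.Ioi 0, ENNReal.ofReal (Real.rpowIntegrand₀₁ θ t x) =
      ENNReal.ofReal (∫ t in Set.Ioi 0, Real.rpowIntegrand₀₁ θ t 1) * ENNReal.ofReal (x ^ θ) := by
  rw [← ofReal_integral_eq_lintegral_ofReal (Real.integrableOn_rpowIntegrand₀₁_Ioi hθ hx),
    Real.integral_rpowIntegrand₀₁_eq_rpow_mul_const hθ hx, mul_comm,
    ENNReal.ofReal_mul (Real.integral_rpowIntegrand₀₁_one_pos hθ).le]
  filter_upwards [ae_restrict_mem measurableSet_Ioi] with t ht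
  exact Real.rpowIntegrand₀₁_nonneg hθ.1 (le_of_lt ht) hx

/-- For 0 < θ < 1, S^θ is a constant multiple of ∫ t^{θ-1} S/(t+S) dt over t > 0, so the bound for
all truncations integrates to one for S^θ with the same K. -/
theorem tsum_rpow_mul_le_of_cutoff {S : ℕ → ℝ} (hS : ∀ n, 0 < S n) {p q : ℕ → ℝ≥0∞} {K : ℝ≥0∞}
    (hK : K ≠ ⊤) (h : ∀ l : ℝ, 0 < l → ∑' n, ENNReal.ofReal (S n / (l + S n)) * p n ≤
      K * ∑' n, ENNReal.ofReal (S n / (l + S n)) * q n) {θ : ℝ} (hθ0 : 0 < θ) (hθ1 : θ ≤ 1) :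
    ∑' n, ENNReal.ofReal (S n ^ θ) * p n ≤ K * ∑' n, ENNReal.ofReal (S n ^ θ) * q n := by
  rcases hθ1.eq_or_lt with rfl | hθ1
  · simpa only [Real.rpow_one] using tsum_mul_le_of_cutoff hS h
  have hθ : θ ∈ Set.Ioo 0 1 := ⟨hθ0, hθ1⟩
  set c := ENNReal.ofReal (∫ t in Set.Ioi 0, Real.rpowIntegrand₀₁ θ t 1) with hc
  have hc0 : c ≠ 0 := by simp [hc, Real.integral_rpowIntegrand₀₁_one_pos hθ]
  have hmeas : ∀ n, AEMeasurable (fun t => ENNReal.ofReal (Real.rpowIntegrand₀₁ θ t (S n)))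
      (volume.restrict (Set.Ioi 0)) := fun n =>
    (Real.integrableOn_rpowIntegrand₀₁_Ioi hθ (hS n).le).aemeasurable.ennreal_ofReal
  have key : ∀ p : ℕ → ℝ≥0∞, c * ∑' n, ENNReal.ofReal (S n ^ θ) * p n =
      ∫⁻ t in Set.Ioi 0, ENNReal.ofReal (t ^ (θ - 1)) *
        ∑' n, ENNReal.ofReal (S n / (t + S n)) * p n := by
    intro p
    rw [← ENNReal.tsum_mul_left]
    simp_rw [← mul_assoc, hc, ← lintegral_rpowIntegrand hθ (hS _).le]
    have e : ∀ n, (∫⁻ t in Set.Ioi 0, ENNReal.ofReal (Real.rpowIntegrand₀₁ θ t (S n))) * p n =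
        ∫⁻ t in Set.Ioi 0, ENNReal.ofReal (Real.rpowIntegrand₀₁ θ t (S n)) * p n := fun n =>
      (lintegral_mul_const'' _ (hmeas n)).symm
    simp_rw [e]
    rw [← lintegral_tsum fun n => (hmeas n).mul_const _]
    refine setLIntegral_congr_fun measurableSet_Ioi fun t ht => ?_
    rw [← ENNReal.tsum_mul_left]
    refine tsum_congr fun n => ?_
    rw [← mul_assoc, ← ENNReal.ofReal_mul (Real.rpow_nonneg (le_of_lt ht) _),
      Real.rpowIntegrand₀₁_eq_pow_div hθ (le_of_lt ht) (hS n).le]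
    congr 2
    ring
  rw [← ENNReal.mul_le_mul_iff_right hc0 ENNReal.ofReal_ne_top, mul_left_comm, key, key,
    ← lintegral_const_mul' _ _ hK]
  refine setLIntegral_mono' measurableSet_Ioi fun t ht => ?_
  rw [mul_left_comm]
  gcongr
  exact h t ht

/-! ### Moments of the weight -/

/-- The integral of `⟨z⟩^{2s} |z|^{2n}` against the Gaussian. -/
def moment (s : ℝ) (n : ℕ) : ℝ≥0∞ :=
  ∫⁻ z : ℂ, ENNReal.ofReal ((1 + ‖z‖ ^ 2) ^ s * Real.exp (-‖z‖ ^ 2)) * ENNReal.ofReal (‖z‖ ^ (2 * n))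

theorem rpow_le_mul_one_add_div {x a θ : ℝ} (hx : 0 ≤ x) (ha : 0 < a) (hθ0 : 0 ≤ θ) (hθ1 : θ ≤ 1) :
    x ^ θ ≤ a ^ θ * (1 + x / a) := by
  have h1 : (x / a) ^ θ ≤ 1 + x / a := by
    rcases le_total (x / a) 1 with h | h
    · exact (Real.rpow_le_one (by positivity) h hθ0).trans (by have : 0 ≤ x / a := by positivity
                                                               linarith)
    · calc (x / a) ^ θ ≤ (x / a) ^ (1 : ℝ) := Real.rpow_le_rpow_of_exponent_le h hθ1
        _ ≤ _ := by rw [Real.rpow_one]; linarith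
  calc x ^ θ = a ^ θ * (x / a) ^ θ := by
        rw [← Real.mul_rpow ha.le (by positivity), mul_div_cancel₀ _ ha.ne']
    _ ≤ _ := by gcongr

/-- Since θ ≤ 1, ((1+|z|²)^k)^θ lies below an affine function of (1+|z|²)^k scaled by a = 2^k S.
This leaves the integer moment (n+k)! = n!(n+1)⋯(n+k), whose ratio to n! is at most S. -/
theorem moment_le {k : ℕ} {s θ T : ℝ} (hθ0 : 0 < θ) (hθ1 : θ ≤ 1) (hk : k * θ = s) (hT : 1 ≤ T)
    (n : ℕ) : moment s n ≤
      ENNReal.ofReal (2 * 2 ^ s * eigen k T n ^ θ * (π * n !)) := by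
  set S := eigen k T n with hSdef
  have hS : 0 < S := eigen_pos k T n
  set a : ℝ := 2 ^ k * S with ha
  have ha0 : 0 < a := by positivity
  have hpt : ∀ z : ℂ, (1 + ‖z‖ ^ 2) ^ s ≤ a ^ θ * (1 + 1 / S) + a ^ θ / S * ‖z‖ ^ (2 * k) := by
    intro z
    have h1 : (1 + ‖z‖ ^ 2) ^ s = ((1 + ‖z‖ ^ 2) ^ k) ^ θ := by
      rw [← hk, Real.rpow_mul (by positivity), Real.rpow_natCast]
    have h2 : (1 + ‖z‖ ^ 2) ^ k ≤ 2 ^ k * (1 + ‖z‖ ^ (2 * k)) := by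
      have := add_pow_le (zero_le_one' ℝ) (sq_nonneg ‖z‖) k
      rw [one_pow, ← pow_mul] at this
      refine this.trans ?_
      gcongr
      · norm_num
      · omega
    rw [h1]
    refine (rpow_le_mul_one_add_div (by positivity) ha0 hθ0.le hθ1).trans ?_
    have h3 : (1 + ‖z‖ ^ 2) ^ k / a ≤ (1 + ‖z‖ ^ (2 * k)) / S := by
      rw [ha, div_le_div_iff₀ (by positivity) hS]
      nlinarith
    calc a ^ θ * (1 + (1 + ‖z‖ ^ 2) ^ k / a) ≤ a ^ θ * (1 + (1 + ‖z‖ ^ (2 * k)) / S) := by gcongr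
      _ = _ := by ring
  calc moment s n ≤ ∫⁻ z : ℂ, (ENNReal.ofReal (a ^ θ * (1 + 1 / S)) *
        (ENNReal.ofReal (Real.exp (-‖z‖ ^ 2)) * ENNReal.ofReal (‖z‖ ^ (2 * n))) +
        ENNReal.ofReal (a ^ θ / S) *
        (ENNReal.ofReal (Real.exp (-‖z‖ ^ 2)) * ENNReal.ofReal (‖z‖ ^ (2 * (n + k))))) := by
        refine lintegral_mono fun z => ?_
        rw [← ENNReal.ofReal_mul (by positivity), ← ENNReal.ofReal_mul (by positivity),
          ← ENNReal.ofReal_mul (by positivity), ← ENNReal.ofReal_mul (by positivity),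
          ← ENNReal.ofReal_mul (by positivity), ← ENNReal.ofReal_add (by positivity) (by positivity)]
        refine ENNReal.ofReal_le_ofReal ?_
        have : 0 ≤ Real.exp (-‖z‖ ^ 2) * ‖z‖ ^ (2 * n) := by positivity
        have h4 := mul_le_mul_of_nonneg_right (hpt z) this
        have h5 : ‖z‖ ^ (2 * (n + k)) = ‖z‖ ^ (2 * k) * ‖z‖ ^ (2 * n) := by ring
        rw [h5]
        linarith
    _ = ENNReal.ofReal (a ^ θ * (1 + 1 / S) * (π * n !) + a ^ θ / S * (π * (n + k)!)) := by
        rw [lintegral_add_left (by fun_prop), lintegral_const_mul _ (by fun_prop),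
          lintegral_const_mul _ (by fun_prop), lintegral_moment, lintegral_moment,
          ← ENNReal.ofReal_mul (by positivity), ← ENNReal.ofReal_mul (by positivity),
          ← ENNReal.ofReal_add (by positivity) (by positivity)]
    _ ≤ _ := by
        refine ENNReal.ofReal_le_ofReal ?_
        have h1 : ((n + k)! : ℝ) = n ! * (n + 1).ascFactorial k := by
          exact_mod_cast (Nat.factorial_mul_ascFactorial n k).symm
        have h2 : 1 + ((n + 1).ascFactorial k : ℝ) ≤ S := by
          rw [hSdef, eigen]
          gcongr
          exact one_le_pow₀ hT
        have h3 : a ^ θ = 2 ^ s * S ^ θ := by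
          rw [ha, Real.mul_rpow (by positivity) hS.le, ← Real.rpow_natCast, ← Real.rpow_mul (by norm_num),
            hk]
        have h4 : (1 + ((n + 1).ascFactorial k : ℝ)) / S ≤ 1 := by rwa [div_le_one hS]
        calc a ^ θ * (1 + 1 / S) * (π * n !) + a ^ θ / S * (π * (n + k)!) =
            a ^ θ * (π * n !) * (1 + (1 + ((n + 1).ascFactorial k : ℝ)) / S) := by rw [h1]; ring
          _ ≤ a ^ θ * (π * n !) * (1 + 1) := by gcongr
          _ = _ := by rw [h3]; ring

/-- Chain z^s ≥ 1 + s log z and log z ≥ 1 - 1/z. This gives a Jensen-type lower bound on the moment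
of order s from an upper bound on the inverse moment. -/
theorem one_add_le_rpow_add {z s : ℝ} (hz : 0 < z) (hs : 0 ≤ s) : 1 + s ≤ z ^ s + s * z⁻¹ := by
  have h1 := Real.one_sub_inv_le_log_of_pos hz
  have h2 := Real.add_one_le_exp (Real.log z * s)
  rw [← Real.rpow_def_of_pos hz] at h2
  nlinarith

theorem le_moment {s : ℝ} (hs : 0 ≤ s) (n : ℕ) :
    ENNReal.ofReal ((((n : ℝ) + 1) / 2) ^ s * (π * n !)) ≤ moment s n := by
  -- Against |z|^{2n} e^{-|z|²}, normalized, the mean of |z|⁻² is 1/n for n ≥ 1, and (n+1)/2 ≤ n;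
  -- for n = 0, b = 1/2 still works with (1+|z|²)⁻¹ ≤ 1.
  set b : ℝ := ((n : ℝ) + 1) / 2 with hb
  have hb0 : 0 < b := by positivity
  have hbs : 0 < b ^ s := by positivity
  set w : ℂ → ℝ≥0∞ := fun z =>
    ENNReal.ofReal (Real.exp (-‖z‖ ^ 2)) * ENNReal.ofReal (‖z‖ ^ (2 * n)) with hw
  have hwm : Measurable w := by fun_prop
  have hY : ∫⁻ z : ℂ, ENNReal.ofReal (b * (1 + ‖z‖ ^ 2)⁻¹) * w z ≤ ENNReal.ofReal (π * n !) := by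
    cases n with
    | zero =>
      rw [← lintegral_moment]
      refine lintegral_mono fun z => mul_le_of_le_one_left bot_le ?_
      rw [ENNReal.ofReal_le_one, hb, ← div_eq_mul_inv, div_le_one (by positivity)]
      push_cast
      nlinarith [sq_nonneg ‖z‖]
    | succ n =>
      calc _ ≤ ∫⁻ z : ℂ, ENNReal.ofReal b *
            (ENNReal.ofReal (Real.exp (-‖z‖ ^ 2)) * ENNReal.ofReal (‖z‖ ^ (2 * n))) := by
            refine lintegral_mono fun z => ?_
            rw [hw]
            simp only
            rw [← ENNReal.ofReal_mul (by positivity), ← ENNReal.ofReal_mul (by positivity),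
              ← ENNReal.ofReal_mul (by positivity), ← ENNReal.ofReal_mul (by positivity)]
            refine ENNReal.ofReal_le_ofReal ?_
            have h1 : (1 + ‖z‖ ^ 2)⁻¹ * ‖z‖ ^ 2 ≤ 1 := by
              rw [inv_mul_le_iff₀ (by positivity)]
              linarith
            have h2 : ‖z‖ ^ (2 * (n + 1)) = ‖z‖ ^ 2 * ‖z‖ ^ (2 * n) := by ring
            rw [h2]
            calc _ = b * (Real.exp (-‖z‖ ^ 2) * ‖z‖ ^ (2 * n)) * ((1 + ‖z‖ ^ 2)⁻¹ * ‖z‖ ^ 2) := by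
                  ring
              _ ≤ _ := mul_le_of_le_one_right (by positivity) h1
        _ = ENNReal.ofReal (b * (π * n !)) := by
            rw [lintegral_const_mul _ (by fun_prop), lintegral_moment,
              ← ENNReal.ofReal_mul (by positivity)]
        _ ≤ _ := by
            refine ENNReal.ofReal_le_ofReal ?_
            rw [Nat.factorial_succ, hb]
            push_cast
            have : 0 < π * n ! := by positivity
            have hn : (0 : ℝ) ≤ n := Nat.cast_nonneg n
            nlinarith
  have hX : ENNReal.ofReal (b ^ s) * ∫⁻ z : ℂ, ENNReal.ofReal (((1 + ‖z‖ ^ 2) / b) ^ s) * w z =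
      moment s n := by
    rw [← lintegral_const_mul _ (by fun_prop), moment]
    refine lintegral_congr fun z => ?_
    rw [hw, ENNReal.ofReal_mul (by positivity), ← mul_assoc, ← mul_assoc,
      ← ENNReal.ofReal_mul (by positivity), ← Real.mul_rpow (by positivity) (by positivity),
      mul_div_cancel₀ _ hb0.ne']
  have hle : ENNReal.ofReal (1 + s) * ENNReal.ofReal (π * n !) ≤
      (∫⁻ z : ℂ, ENNReal.ofReal (((1 + ‖z‖ ^ 2) / b) ^ s) * w z) +
        ENNReal.ofReal s * ENNReal.ofReal (π * n !) := by
    calc _ = ∫⁻ z : ℂ, ENNReal.ofReal (1 + s) * w z := by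
          rw [lintegral_const_mul _ hwm, lintegral_moment]
      _ ≤ ∫⁻ z : ℂ, (ENNReal.ofReal (((1 + ‖z‖ ^ 2) / b) ^ s) * w z +
          ENNReal.ofReal s * (ENNReal.ofReal (b * (1 + ‖z‖ ^ 2)⁻¹) * w z)) := by
          refine lintegral_mono fun z => ?_
          rw [← mul_assoc (ENNReal.ofReal s), ← add_mul, ← ENNReal.ofReal_mul hs,
            ← ENNReal.ofReal_add (by positivity) (by positivity)]
          refine mul_le_mul' (ENNReal.ofReal_le_ofReal ?_) le_rfl
          have := one_add_le_rpow_add (z := (1 + ‖z‖ ^ 2) / b) (by positivity) hs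
          rwa [inv_div, div_eq_mul_inv b] at this
      _ ≤ _ := by
          rw [lintegral_add_left (by fun_prop), lintegral_const_mul _ (by fun_prop)]
          gcongr
  have hfin : ENNReal.ofReal (π * n !) ≤
      ∫⁻ z : ℂ, ENNReal.ofReal (((1 + ‖z‖ ^ 2) / b) ^ s) * w z := by
    rw [ENNReal.ofReal_add zero_le_one hs, ENNReal.ofReal_one, add_mul, one_mul] at hle
    exact (ENNReal.add_le_add_iff_right
      (ENNReal.mul_ne_top ENNReal.ofReal_ne_top ENNReal.ofReal_ne_top)).1 hle
  rw [← hX, ENNReal.ofReal_mul hbs.le]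
  gcongr

/-- Both T^{2k} and ((k+1)(n+1))^k are at least 1, so twice their product dominates the sum; this is
where the growth T^{2s} enters. -/
theorem eigen_rpow_le {k : ℕ} {s θ T : ℝ} (hθ0 : 0 < θ) (hθ1 : θ ≤ 1) (hk : k * θ = s)
    (hT : 1 ≤ T) (n : ℕ) :
    eigen k T n ^ θ ≤ 2 * (2 * (k + 1)) ^ s * (T ^ s) ^ 2 * (((n : ℝ) + 1) / 2) ^ s := by
  have hT0 : 0 < T := by linarith
  have hT1 : 1 ≤ T ^ (2 * k) := one_le_pow₀ hT
  have h1 : ((n + 1).ascFactorial k : ℝ) ≤ (((k : ℝ) + 1) * (n + 1)) ^ k := by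
    calc ((n + 1).ascFactorial k : ℝ) ≤ ((n + k : ℕ) : ℝ) ^ k := by
          exact_mod_cast Nat.ascFactorial_le_pow_add n k
      _ ≤ _ := by
          gcongr
          push_cast
          have : (0 : ℝ) ≤ k * n := by positivity
          nlinarith
  have h2 : (1 : ℝ) ≤ (((k : ℝ) + 1) * (n + 1)) ^ k := by
    refine one_le_pow₀ ?_
    have : (0 : ℝ) ≤ k := by positivity
    have : (0 : ℝ) ≤ n := by positivity
    nlinarith
  have h3 : eigen k T n ≤ 2 * (T ^ 2 * (((k : ℝ) + 1) * (n + 1))) ^ k := by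
    rw [eigen, mul_pow, ← pow_mul]
    nlinarith
  have hrew : (2 * (T ^ 2 * (((k : ℝ) + 1) * (n + 1))) ^ k) ^ θ =
      2 ^ θ * ((2 * (k + 1)) ^ s * (T ^ s) ^ 2 * (((n : ℝ) + 1) / 2) ^ s) := by
    rw [Real.mul_rpow (by norm_num) (by positivity), ← Real.rpow_natCast _ k,
      ← Real.rpow_mul (by positivity), hk]
    congr 1
    have e : (T ^ s) ^ 2 = (T ^ 2) ^ s := by
      rw [← Real.rpow_natCast, ← Real.rpow_natCast, ← Real.rpow_mul hT0.le, ← Real.rpow_mul hT0.le,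
        mul_comm]
    rw [e, ← Real.mul_rpow (by positivity) (by positivity),
      ← Real.mul_rpow (by positivity) (by positivity)]
    congr 1
    ring
  have h4 : (2 : ℝ) ^ θ ≤ 2 := by
    calc (2 : ℝ) ^ θ ≤ 2 ^ (1 : ℝ) := Real.rpow_le_rpow_of_exponent_le (by norm_num) hθ1
      _ = 2 := Real.rpow_one 2
  calc eigen k T n ^ θ ≤ (2 * (T ^ 2 * (((k : ℝ) + 1) * (n + 1))) ^ k) ^ θ :=
        Real.rpow_le_rpow (eigen_pos k T n).le h3 hθ0.le
    _ ≤ 2 * ((2 * (k + 1)) ^ s * (T ^ s) ^ 2 * (((n : ℝ) + 1) / 2) ^ s) := by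
        rw [hrew]
        gcongr
    _ = _ := by ring

/-! ### Weighted norms -/

theorem bracket_sq {V : Type*} [Norm V] (x : V) : bracket x ^ 2 = 1 + ‖x‖ ^ 2 :=
  Real.sq_sqrt (by positivity)

theorem one_le_bracket {V : Type*} [Norm V] (x : V) : 1 ≤ bracket x := by
  rw [bracket, Real.one_le_sqrt]
  linarith [sq_nonneg ‖x‖]

theorem norm_le_bracket {V : Type*} [Norm V] (x : V) : ‖x‖ ≤ bracket x :=
  Real.le_sqrt_of_sq_le (by linarith)

theorem continuous_bracket : Continuous fun z : ℂ => bracket z := by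
  unfold bracket
  fun_prop

theorem continuous_weighted (s : ℝ) {u : ℂ → ℂ} (hu : Continuous u) :
    Continuous (weighted s u) := by
  have h : Continuous fun z : ℂ => bracket z ^ s :=
    continuous_bracket.rpow_const fun z => Or.inl (by linarith [one_le_bracket z])
  unfold weighted
  fun_prop

theorem eLpNorm_weighted_toFock_sq (s : ℝ) {f : ℂ → ℂ} (hf : Differentiable ℂ f) :
    eLpNorm (weighted s (toFock f)) 2 volume ^ 2 =
      ∑' n, ENNReal.ofReal (mass f n / n !) * moment s n := by
  rw [eLpNorm_two_sq]
  have h : ∀ z, ENNReal.ofReal (‖weighted s (toFock f) z‖ ^ 2) =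
      ENNReal.ofReal ((1 + ‖z‖ ^ 2) ^ s * Real.exp (-‖z‖ ^ 2)) * ENNReal.ofReal (‖f z‖ ^ 2) := by
    intro z
    have hb : 0 ≤ bracket z := by linarith [one_le_bracket z]
    rw [weighted, norm_mul, mul_pow, norm_toFock_sq, norm_real,
      Real.norm_of_nonneg (Real.rpow_nonneg hb s), ← Real.rpow_natCast (bracket z ^ s),
      ← Real.rpow_mul hb, mul_comm s, Real.rpow_mul hb, Real.rpow_natCast, bracket_sq,
      ← ENNReal.ofReal_mul (by positivity)]
    congr 1
    ring
  simp_rw [h]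
  rw [lintegral_radial hf
    (ρ := fun r => ENNReal.ofReal ((1 + r ^ 2) ^ s * Real.exp (-r ^ 2))) (by fun_prop)]
  refine tsum_congr fun n => ?_
  rw [mass, moment, div_div, ← sq]

/-- A set of full measure is dense and g is continuous, so the essential bound holds everywhere. The
absolute value covers a negative C. -/
theorem norm_le_of_eLpNorm_top_le {g : ℂ → ℂ} (hg : Continuous g) {C : ℝ}
    (h : eLpNorm g ∞ volume ≤ ENNReal.ofReal C) (z : ℂ) : ‖g z‖ ≤ |C| := by
  have h1 : ∀ᵐ z, ‖g z‖ ≤ |C| := by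
    filter_upwards [ae_le_eLpNormEssSup (f := g) (μ := volume)] with z hz
    rw [eLpNorm_exponent_top] at h
    have h2 := (hz.trans h).trans (ENNReal.ofReal_le_ofReal (le_abs_self C))
    rwa [← ofReal_norm, ENNReal.ofReal_le_ofReal_iff (abs_nonneg C)] at h2
  have hd := Measure.dense_of_ae h1
  have hcl : IsClosed {z | ‖g z‖ ≤ |C|} := isClosed_le hg.norm continuous_const
  exact hcl.closure_subset (hd z)

theorem contDiff_iterate_dz {V : ℂ → ℂ} (hV : ContDiff ℝ ∞ V) (j : ℕ) :
    ContDiff ℝ ∞ (dz^[j] V) := by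
  induction j with
  | zero => exact hV
  | succ j ih => rw [Function.iterate_succ_apply']; exact contDiff_dz ih

theorem exists_exponent {s : ℝ} (hs : 0 ≤ s) :
    ∃ θ : ℝ, 0 < θ ∧ θ ≤ 1 ∧ (⌈s⌉₊ : ℝ) * θ = s := by
  rcases hs.eq_or_lt with rfl | hs
  -- For s = 0 the ceiling is 0 and any θ would do.
  · exact ⟨1, one_pos, le_rfl, by simp⟩
  · have hk : (0 : ℝ) < ⌈s⌉₊ := by exact_mod_cast Nat.ceil_pos.2 hs
    exact ⟨s / ⌈s⌉₊, by positivity, by rw [div_le_one hk]; exact Nat.le_ceil s,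
      mul_div_cancel₀ _ hk.ne'⟩

theorem IsSolution.eLpNorm_weighted_sq_le {s : ℝ} (hs : 0 ≤ s) {δ C₀ : ℝ} {W : ℝ → ℂ → ℝ}
    (hW : IsSmoothPotential W)
    (hC₀ : ∀ t : ℝ, ∀ k : ℕ, k ≤ ⌈s⌉₊ →
      eLpNorm (dz^[k] fun z => (W t z : ℂ)) ∞ volume ≤ ENNReal.ofReal C₀)
    {u₀ : ℂ → ℂ} {u : ℝ → ℂ → ℂ} (hu : IsSolution δ W u₀ u) (t : ℝ) :
    eLpNorm (weighted s (u t)) 2 volume ^ 2 ≤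
      ENNReal.ofReal (Real.exp (2 * 2 ^ ⌈s⌉₊) * (2 * 2 ^ s) * (2 * (2 * (⌈s⌉₊ + 1)) ^ s) *
        (bracket (C₀ * t) ^ s) ^ 2) * eLpNorm (weighted s u₀) 2 volume ^ 2 := by
  obtain ⟨θ, hθ0, hθ1, hk⟩ := exists_exponent hs
  set k := ⌈s⌉₊ with hkdef
  -- T is frozen at the final time, so the weights do not move during the evolution.
  set T := bracket (C₀ * t) with hTdef
  have hT : 1 ≤ T := one_le_bracket _
  have hT0 : 0 < T := by linarith
  set K := Real.exp (2 * 2 ^ k) with hK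
  have hA : ∀ t, ∀ j ≤ k, ∀ z, ‖dz^[j] (fun z => (W t z : ℂ)) z‖ ≤ |C₀| := fun t j hj z =>
    norm_le_of_eLpNorm_top_le
      (contDiff_iterate_dz (ofRealCLM.contDiff.comp (hW.smooth t)) j).continuous (hC₀ t j hj) z
  set f := symbol (u t) with hf
  set f₀ := symbol (u 0) with hf₀
  have hfs := hu.isFockSymbol t
  have hfs₀ := hu.isFockSymbol 0
  -- |C₀t| ≤ T makes the Grönwall factor independent of t, C₀ and l.
  have hexp : Real.exp (2 * (2 ^ k * (|C₀| / T)) * |t|) ≤ K := by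
    refine Real.exp_le_exp.2 ?_
    have h1 : |C₀| * |t| / T ≤ 1 := by
      rw [div_le_one hT0, ← abs_mul]
      exact norm_le_bracket (C₀ * t)
    calc 2 * (2 ^ k * (|C₀| / T)) * |t| = 2 * 2 ^ k * (|C₀| * |t| / T) := by ring
      _ ≤ 2 * 2 ^ k * 1 := by gcongr
      _ = _ := mul_one _
  have henergy : ∀ l : ℝ, 0 < l →
      ∑' n, ENNReal.ofReal (eigen k T n / (l + eigen k T n)) * ENNReal.ofReal (mass f n) ≤
        ENNReal.ofReal K *
          ∑' n, ENNReal.ofReal (eigen k T n / (l + eigen k T n)) * ENNReal.ofReal (mass f₀ n) := by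
    intro l hl
    have h := hu.cutoff_energy_le hT hl hW.smooth hA t
    have hsum : ∀ g, IsFockSymbol g →
        ∑' n, ENNReal.ofReal (eigen k T n / (l + eigen k T n)) * ENNReal.ofReal (mass g n) =
          ENNReal.ofReal (∑' n, cutoff k T l n * mass g n) := fun g hg => by
      rw [ENNReal.ofReal_tsum_of_nonneg
        (fun n => mul_nonneg (cutoff_nonneg k T hl n) (mass_nonneg g n))
        (hg.summable.of_nonneg_of_le
          (fun n => mul_nonneg (cutoff_nonneg k T hl n) (mass_nonneg g n))
          fun n => mul_le_of_le_one_left (mass_nonneg g n) (cutoff_le_one k T hl n))]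
      exact tsum_congr fun n => (ENNReal.ofReal_mul (cutoff_nonneg k T hl n)).symm
    rw [hsum f hfs, hsum f₀ hfs₀, ← ENNReal.ofReal_mul (Real.exp_pos _).le]
    refine ENNReal.ofReal_le_ofReal (h.trans ?_)
    rw [mul_comm]
    gcongr
    exact tsum_nonneg fun n => mul_nonneg (cutoff_nonneg k T hl n) (mass_nonneg f₀ n)
  have hinter := tsum_rpow_mul_le_of_cutoff (eigen_pos k T) ENNReal.ofReal_ne_top henergy hθ0 hθ1
  set c₁ : ℝ := 2 * 2 ^ s with hc₁
  set c₂ : ℝ := 2 * (2 * (k + 1)) ^ s * (T ^ s) ^ 2 with hc₂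
  have hc₁0 : 0 < c₁ := by positivity
  have hc₂0 : 0 < c₂ := by positivity
  have hS0 : ∀ n, 0 ≤ eigen k T n ^ θ := fun n => Real.rpow_nonneg (eigen_pos k T n).le _
  have hup : eLpNorm (weighted s (u t)) 2 volume ^ 2 ≤ ENNReal.ofReal (c₁ * π) *
      ∑' n, ENNReal.ofReal (eigen k T n ^ θ) * ENNReal.ofReal (mass f n) := by
    rw [← toFock_symbol (u t), eLpNorm_weighted_toFock_sq s hfs.differentiable,
      ← ENNReal.tsum_mul_left]
    refine ENNReal.tsum_le_tsum fun n => ?_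
    have hm := mass_nonneg f n
    have := hS0 n
    refine (mul_le_mul' le_rfl (moment_le hθ0 hθ1 hk hT n)).trans ?_
    rw [← ENNReal.ofReal_mul (by positivity), ← ENNReal.ofReal_mul (by positivity),
      ← ENNReal.ofReal_mul (by positivity)]
    refine ENNReal.ofReal_le_ofReal (le_of_eq ?_)
    rw [hc₁, ← hf]
    field_simp
  have hdown : ENNReal.ofReal π *
      ∑' n, ENNReal.ofReal (eigen k T n ^ θ) * ENNReal.ofReal (mass f₀ n) ≤
        ENNReal.ofReal c₂ * eLpNorm (weighted s u₀) 2 volume ^ 2 := by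
    rw [← hu.initial, ← toFock_symbol (u 0), eLpNorm_weighted_toFock_sq s hfs₀.differentiable,
      ← ENNReal.tsum_mul_left, ← ENNReal.tsum_mul_left]
    refine ENNReal.tsum_le_tsum fun n => ?_
    have hm := mass_nonneg f₀ n
    have := hS0 n
    refine le_trans ?_ (mul_le_mul' le_rfl (mul_le_mul' le_rfl (le_moment hs n)))
    rw [← ENNReal.ofReal_mul (by positivity), ← ENNReal.ofReal_mul (by positivity),
      ← ENNReal.ofReal_mul (by positivity), ← ENNReal.ofReal_mul (by positivity)]
    refine ENNReal.ofReal_le_ofReal ?_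
    have h2 := eigen_rpow_le hθ0 hθ1 hk hT n
    calc π * (eigen k T n ^ θ * mass f₀ n) ≤
          π * (c₂ * (((n : ℝ) + 1) / 2) ^ s * mass f₀ n) := by gcongr
      _ = _ := by
        rw [← hf₀]
        have : (n ! : ℝ) ≠ 0 := by positivity
        field_simp
  calc _ ≤ _ := hup
    _ ≤ ENNReal.ofReal (c₁ * π) * (ENNReal.ofReal K *
        ∑' n, ENNReal.ofReal (eigen k T n ^ θ) * ENNReal.ofReal (mass f₀ n)) := by gcongr
    _ = ENNReal.ofReal (K * c₁) * (ENNReal.ofReal π *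
        ∑' n, ENNReal.ofReal (eigen k T n ^ θ) * ENNReal.ofReal (mass f₀ n)) := by
      rw [ENNReal.ofReal_mul hc₁0.le, ENNReal.ofReal_mul (Real.exp_pos _).le]
      ring
    _ ≤ ENNReal.ofReal (K * c₁) * (ENNReal.ofReal c₂ * eLpNorm (weighted s u₀) 2 volume ^ 2) := by
      gcongr
    _ = _ := by
      rw [← mul_assoc, ← ENNReal.ofReal_mul (by positivity), hc₂]
      congr 2
      ring

end LLL

end

theorem theorem2p2 (s : ℝ) (hs : 0 ≤ s) :
    ∃ C : ℝ, 0 < C ∧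
      ∀ (δ C₀ : ℝ) (W : ℝ → ℂ → ℝ), LLL.IsSmoothPotential W →
        (∀ t : ℝ, ∀ k : ℕ, k ≤ ⌈s⌉₊ →
          eLpNorm (LLL.dz^[k] fun z => (W t z : ℂ)) ∞ volume ≤ ENNReal.ofReal C₀) →
        ∀ (u₀ : ℂ → ℂ) (u : ℝ → ℂ → ℂ), u₀ ∈ LLL.weightedFock s →
          LLL.IsSolution δ W u₀ u →
          ∀ t : ℝ,
            MemLp (LLL.weighted s (u t)) 2 volume ∧
            eLpNorm (LLL.weighted s (u t)) 2 volume ≤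
              ENNReal.ofReal (C * LLL.bracket (C₀ * t) ^ s) *
                eLpNorm (LLL.weighted s u₀) 2 volume := by
  set B : ℝ := Real.exp (2 * 2 ^ ⌈s⌉₊) * (2 * 2 ^ s) * (2 * (2 * (⌈s⌉₊ + 1)) ^ s) with hB
  have hB0 : 0 < B := by positivity
  -- B is the constant of the squared estimate and depends on s only.
  refine ⟨√B, Real.sqrt_pos.2 hB0, fun δ C₀ W hW hC₀ u₀ u hu₀ hu t => ?_⟩
  have hb : 0 ≤ LLL.bracket (C₀ * t) ^ s :=
    Real.rpow_nonneg (by linarith [LLL.one_le_bracket (C₀ * t)]) s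
  have hle : eLpNorm (LLL.weighted s (u t)) 2 volume ≤
      ENNReal.ofReal (√B * LLL.bracket (C₀ * t) ^ s) * eLpNorm (LLL.weighted s u₀) 2 volume := by
    rw [← ENNReal.pow_le_pow_left_iff two_ne_zero, mul_pow, ← ENNReal.ofReal_pow (by positivity),
      mul_pow, Real.sq_sqrt hB0.le]
    exact hu.eLpNorm_weighted_sq_le hs hW hC₀ t
  refine ⟨⟨?_, hle.trans_lt (ENNReal.mul_lt_top ENNReal.ofReal_lt_top hu₀.2.2)⟩, hle⟩
  have hc : Continuous (u t) := by
    rw [← LLL.toFock_symbol (u t)]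
    exact LLL.continuous_toFock (hu.isFockSymbol t).differentiable
  exact (LLL.continuous_weighted s hc).aestronglyMeasurable
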